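/- Let $\mu=(\mu_n)_{n\ge 1}$ be a sequence of non-negative real numbers with $\mu_n\to 0$. In the real Hilbert space $\ell^2$, with norm $\|\cdot\|_2$, consider the ellipsoid $$\mathcal E_\mu=\Big\{x\in\ell^2 : x_n=0 \text{ if } \mu_n=0,\ \text{ and } \sum_{n:\mu_n>0}|x_n/\mu_n|^2\le 1\Big\}.$$ For $\varepsilon>0$ let $M_\mu(\varepsilon)=|\{n : \mu_n\ge\varepsilon\}|$ and $I_1(\varepsilon)=\int_\varepsilon^\infty \frac{M_\mu(u)}{u}\,du$, and let $H(\varepsilon;\mathcal E_\mu)=\ln N(\varepsilon;\mathcal E_\mu)$, where $N(\varepsilon;\mathcal E_\mu)$ is the smallest cardinality of a set of points of $\ell^2$ such that every point of $\mathcal E_\mu$ is at distance at most $\varepsilon$ from one of them. Suppose that $M_\mu$ satisfies the following regularity condition (RC): there is a non-increasing continuously differentiable function $f:(0,\infty)\to(0,\infty)$ such that $M_\mu(x)\sim f(x)$ as $x\to 0^+$ and such that $\rho(t)=\frac{d}{dt}\ln f(e^{-t})$, $t>0$, satisfies either (i) $\rho(t)$ has a finite limit as $t\to\infty$, or (ii)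 $\rho(t)\to\infty$ as $t\to\infty$, $\ln\rho(t)=O(\rho(t/2))$ as $t\to\infty$, and $\rho$ is non-decreasing on $(t^*,\infty)$ for some $t^*>0$. Then, if at least two of the $\mu_n$ are non-zero, $$H(\varepsilon;\mathcal E_\mu)=I_1(\varepsilon)+O\Big(\min\Big\{M_\mu(\varepsilon),\sqrt{M_\mu(\varepsilon)\,\ln M_\mu(\varepsilon)\,\ln(1/\varepsilon)}\Big\}\Big)\quad\text{as }\varepsilon\to0^+.$$ Moreover, whether or not at least two of the $\mu_n$ are non-zero, $$H(\varepsilon;\mathcal E_\mu)\sim I_1(\varepsilon)\quad\text{as }\varepsilon\to0^+,$$ and, for every $\varepsilon>0$, $I_1(\varepsilon)$ is finite and $I_1(\varepsilon)=\sum_{n\ge1}\ln_+(\mu_n/\varepsilon)$, where $\ln_+(x)=\max\{\ln x,0\}$ for $x>0$ and $\ln_+(0)=0$. -/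

import Mathlib

open Filter Topology Asymptotics Set

namespace EllipsoidEntropy

/-- The real Hilbert space of square-summable sequences. -/
abbrev L2 : Type := lp (fun _ : ℕ => ℝ) 2

/-- The ellipsoid with semi-axes `μ`. The sum is taken in `[0, ∞]`, so that it always exists. -/
def ellipsoid (μ : ℕ → ℝ) : Set L2 :=
  {x | (∀ n, μ n = 0 → x n = 0) ∧
    ∑' n : {n : ℕ // 0 < μ n}, ENNReal.ofReal (|x n / μ n| ^ 2) ≤ 1}

/-- The semi-axis-counting function: the number of `n` with `μ n ≥ ε`. It is only used for
`ε > 0` and `μ n → 0`, when the set is finite. -/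
noncomputable def semiAxisCount (μ : ℕ → ℝ) (ε : ℝ) : ℕ :=
  {n : ℕ | ε ≤ μ n}.ncard

/-- The type-`τ` integral of the ellipsoid with semi-axes `μ`. -/
noncomputable def typeIntegral (μ : ℕ → ℝ) (τ ε : ℝ) : ℝ :=
  ∫ u in Ioi ε, (semiAxisCount μ u : ℝ) / u ^ τ

/-- The metric entropy `ln N(ε; K)`, where `N(ε; K)` is the smallest cardinality of a set of
points of the ambient space whose closed `ε`-balls cover `K`. -/
noncomputable def metricEntropy (ε : ℝ) (K : Set L2) : ℝ :=
  Real.log ((Metric.externalCoveringNumber ε.toNNReal K).toNat : ℝ)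

/-- The elasticity of `f`: the derivative of `t ↦ ln (f (e ^ (-t)))`. -/
noncomputable def elasticity (f : ℝ → ℝ) : ℝ → ℝ :=
  deriv fun t : ℝ => Real.log (f (Real.exp (-t)))

/-- The regularity condition (RC) on a function `M` on `(0, ∞)`. -/
def RegularityCondition (M : ℝ → ℝ) : Prop :=
  ∃ f : ℝ → ℝ,
    ContDiffOn ℝ 1 f (Ioi 0) ∧ (∀ x, 0 < x → 0 < f x) ∧ AntitoneOn f (Ioi 0) ∧
    M ~[𝓝[>] 0] f ∧
    ((∃ b : ℝ, Tendsto (elasticity f) atTop (𝓝 b)) ∨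
      (Tendsto (elasticity f) atTop atTop ∧
        (fun t => Real.log (elasticity f t)) =O[atTop] (fun t => elasticity f (t / 2)) ∧
        ∃ t₀ : ℝ, 0 < t₀ ∧ MonotoneOn (elasticity f) (Ioi t₀)))

end EllipsoidEntropy

/-!
The metric entropy `H(ε)` of the ellipsoid is compared with
`I₁(ε) = ∑ ln₊ (μ n / ε)`, the logarithm of the volume ratio of the ellipsoid and the `ε`-ball in
the coordinates with `μ n ≥ ε`.

*Lower bound.* Projecting a covering to these coordinates and comparing volumes gives
`I₁(ε) ≤ H(ε)` for every `ε` (`typeIntegral_le_metricEntropy`).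

*Upper bounds.* A volume argument gives `H(ε) ≤ I₁(ε) + O(M(ε / 2))`
(`metricEntropy_le_typeIntegral_add_count`). The sharper bound starts from economical coverings of
balls: in dimension `d` a ball of radius `R` is covered by `(R / r) ^ d` balls of radius `r`, up to
a factor polynomial in `d` and logarithmic in `R / r` (`exists_ball_cover`). Its proof is a greedy version of the random
covering with centres uniform in the ball of radius `√(R² - r²)`; the point is that every `x` in
the large ball sees at least the fraction `(r / R) ^ d / (16 d)` of these centres
(`measure_lens_ge`). The ellipsoid is then divided into `K` blocks of coordinates with comparable
semi-axes. If a point has the share `w k` of the defining sum in block `k`, its part in that block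
lies in a ball of radius `a k * √(w k)`, to be covered by balls of radius `ε √(w k)`. The ratio of
radii does not depend on the shares, the squared errors add up to `ε²`, and the coordinates with
`μ n < ε` need no covering at all. Only the discretized shares have to be counted, which costs
`O(K ln M)`; replacing semi-axes by the largest in their block costs `M ln (1/ε) / K`
(`metricEntropy_le_blocks`, `metricEntropy_le_log_blocks`). Balancing the two gives
`O(√(M ln M ln (1/ε)))` as long as `ln (1/ε) ln M ≤ M` (`exists_metricEntropy_le_sqrt`).

*Asymptotics.* With `t = ln (1/ε)` the regularity condition says that `M` is comparable to
`e ^ F(t)`, where either `F' → 0`, or `F'` is bounded below and at most `e ^ (F / 8)`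
(`RegularityCondition.exists_log`). In both cases `M` changes only by a constant factor when `ε` is
lowered by the factor `e ^ (-1 / M)`, as the discretization of the shares requires. In the first
case `M(ε / 2) = O(M(ε))` and `M = o(I₁)`; in the second the term `√(M ln M ln (1/ε))` is the
smaller one and is `o(I₁)`, because `I₁` is at least a constant times `e ^ (7 F / 8)`.
-/

namespace EllipsoidEntropy
open MeasureTheory Metric Module

/-! ### Covering a Euclidean ball by balls -/

section BallCovering

variable {V : Type*} [NormedAddCommGroup V] [InnerProductSpace ℝ V]

/-- The slice at height between `a` and `b` in direction `e` of the centred ball of radius `R`. -/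
def ballSlab (e : V) (R a b : ℝ) : Set V :=
  {v | ‖v‖ ≤ R ∧ a ≤ inner ℝ e v ∧ inner ℝ e v ≤ b}

lemma ballSlab_subset (e : V) (R a b : ℝ) : ballSlab e R a b ⊆ closedBall 0 R := by
  intro v hv
  simpa using hv.1

variable [MeasurableSpace V] [BorelSpace V]

/-- Translating a slab of the ball towards the centre keeps it inside the ball, so no slab of a
given width has larger volume than the one next to the centre. -/
lemma measure_ballSlab_le (ν : Measure V) [ν.IsAddHaarMeasure] {e : V} (he : ‖e‖ = 1) {R τ : ℝ}
    (hτ : 0 ≤ τ) (j : ℕ) :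
    ν (ballSlab e R (j * τ) ((j + 1) * τ)) ≤ ν (ballSlab e R 0 τ) := by
  rw [← measure_preimage_add ν ((j * τ) • e) (ballSlab e R (j * τ) ((j + 1) * τ))]
  apply measure_mono
  intro w hw
  obtain ⟨h1, h2, h3⟩ := hw
  have hee : inner ℝ e e = (1 : ℝ) := by rw [real_inner_self_eq_norm_sq, he]; norm_num
  rw [inner_add_right, inner_smul_right, hee] at h2 h3
  have hj : 0 ≤ (j : ℝ) * τ := by positivity
  refine ⟨?_, by linarith, by linarith⟩
  refine le_trans ?_ h1
  apply le_of_sq_le_sq _ (norm_nonneg _)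
  rw [norm_add_sq_real, inner_smul_left]
  simp only [conj_trivial]
  have : 0 ≤ (j : ℝ) * τ * inner ℝ e w := mul_nonneg hj (by linarith)
  nlinarith [sq_nonneg ‖((j : ℝ) * τ) • e‖]

variable [FiniteDimensional ℝ V]

/-- If `N` slabs of width `τ` reach from the centre to the boundary, then the slab next to the
centre carries at least the fraction `1 / (2 N)` of the volume of the ball. -/
lemma measure_closedBall_le_ballSlab (ν : Measure V) [ν.IsAddHaarMeasure] {e : V} (he : ‖e‖ = 1)
    {R τ : ℝ} (hτ : 0 < τ) {N : ℕ} (hN0 : 0 < N) (hN : R ≤ N * τ) :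
    ν (closedBall 0 R) ≤ (2 * N : ℕ) * ν (ballSlab e R 0 τ) := by
  have key : ∀ v : V, ‖v‖ ≤ R → 0 ≤ inner ℝ e v →
      ∃ j ∈ Finset.range N, v ∈ ballSlab e R (j * τ) ((j + 1) * τ) := by
    intro v hv h0
    have hle : inner ℝ e v ≤ R := by
      have := real_inner_le_norm e v
      rw [he, one_mul] at this
      exact this.trans hv
    rcases (hle.trans hN).lt_or_eq with h | h
    · refine ⟨⌊inner ℝ e v / τ⌋₊, ?_, hv, ?_, ?_⟩
      · rw [Finset.mem_range, Nat.floor_lt (by positivity), div_lt_iff₀ hτ]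
        exact h
      · rw [← le_div_iff₀ hτ]
        exact Nat.floor_le (by positivity)
      · rw [← div_le_iff₀ hτ]
        exact (Nat.lt_floor_add_one _).le
    · refine ⟨N - 1, by simp [hN0], hv, ?_, ?_⟩
      · rw [h]
        gcongr
        exact Nat.sub_le _ _
      · rw [h]
        have : (N : ℝ) ≤ ((N - 1 : ℕ) : ℝ) + 1 := by
          exact_mod_cast (by omega : N ≤ (N - 1) + 1)
        gcongr
  have hsub : closedBall (0 : V) R ⊆
      (⋃ j ∈ Finset.range N, ballSlab e R (j * τ) ((j + 1) * τ)) ∪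
        -(⋃ j ∈ Finset.range N, ballSlab e R (j * τ) ((j + 1) * τ)) := by
    intro v hv
    rw [mem_closedBall_zero_iff] at hv
    rcases le_total 0 (inner ℝ e v) with h | h
    · left
      simpa using key v hv h
    · right
      have := key (-v) (by simpa using hv) (by simpa [inner_neg_right] using h)
      simpa using this
  have hU : ν (⋃ j ∈ Finset.range N, ballSlab e R (j * τ) ((j + 1) * τ)) ≤
      N * ν (ballSlab e R 0 τ) := by
    refine (measure_biUnion_finset_le _ _).trans ?_
    refine (Finset.sum_le_sum fun j _ => measure_ballSlab_le ν he hτ.le j).trans ?_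
    simp
  calc ν (closedBall 0 R) ≤ _ := measure_mono hsub
    _ ≤ _ := measure_union_le _ _
    _ ≤ N * ν (ballSlab e R 0 τ) + N * ν (ballSlab e R 0 τ) := by
        rw [Measure.measure_neg]
        gcongr
    _ = _ := by push_cast; ring

/-- A ball of radius `r` whose centre lies in the ball of radius `R > r` meets the concentric
ball of radius `ρ = √(R² - r²)` in at least the fraction `(r / R) ^ d`, up to a factor linear in
the dimension `d`. The two spheres are orthogonal when the centre has norm `R`; the intersection
then contains half of a slab of the ball of radius `r ρ / R`. -/
lemma measure_lens_ge (ν : Measure V) [ν.IsAddHaarMeasure] (hd : 0 < finrank ℝ V) {r R : ℝ}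
    (hr : 0 < r) (hrR : r < R) {x : V} (hx : ‖x‖ ≤ R) :
    (r / R) ^ finrank ℝ V / (16 * finrank ℝ V) * ν.real (closedBall 0 (√(R ^ 2 - r ^ 2))) ≤
      ν.real (closedBall x r ∩ closedBall 0 (√(R ^ 2 - r ^ 2))) := by
  set d := finrank ℝ V with hd_def
  have hR : 0 < R := hr.trans hrR
  have hpos : 0 < R ^ 2 - r ^ 2 := by nlinarith
  set ρ := √(R ^ 2 - r ^ 2) with hρ_def
  have hρ : 0 < ρ := Real.sqrt_pos.2 hpos
  have hρ2 : ρ ^ 2 = R ^ 2 - r ^ 2 := Real.sq_sqrt hpos.le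
  have hd1 : (1 : ℝ) ≤ d := by exact_mod_cast hd
  set h := r * ρ / R with hh_def
  have hh : 0 < h := by positivity
  have : Nontrivial V := Module.finrank_pos_iff.1 hd
  obtain ⟨e, he, hxe⟩ : ∃ e : V, ‖e‖ = 1 ∧ x = ‖x‖ • e := by
    rcases eq_or_ne x 0 with rfl | h0
    · obtain ⟨e, he⟩ := exists_norm_eq V (zero_le_one (α := ℝ))
      exact ⟨e, he, by simp⟩
    · refine ⟨‖x‖⁻¹ • x, ?_, ?_⟩
      · rw [norm_smul, norm_inv, norm_norm, inv_mul_cancel₀ (norm_ne_zero_iff.2 h0)]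
      · rw [smul_smul, mul_inv_cancel₀ (norm_ne_zero_iff.2 h0), one_smul]
  set s := ‖x‖ with hs_def
  have hs : 0 ≤ s := norm_nonneg x
  set τ := h / (4 * d) with hτ_def
  have hτ : 0 < τ := by positivity
  set h' := h * (1 - 1 / (2 * d)) with hh'_def
  have hfrac : 1 / (2 * (d : ℝ)) ≤ 1 / 2 := by
    apply one_div_le_one_div_of_le <;> linarith
  have hfrac0 : 0 < 1 / (2 * (d : ℝ)) := by positivity
  have hh'0 : 0 ≤ h' := mul_nonneg hh.le (by linarith)
  have hh'h : h' ≤ h := by rw [hh'_def]; nlinarith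
  have hh'sq : h' ^ 2 ≤ h ^ 2 - 2 * τ * h := by
    have e1 : 2 * τ * h = h ^ 2 * (1 / (2 * d)) := by rw [hτ_def]; field_simp; norm_num
    rw [e1, hh'_def, mul_pow]
    have : (1 - 1 / (2 * (d : ℝ))) ^ 2 ≤ 1 - 1 / (2 * d) := by nlinarith
    nlinarith [sq_nonneg h]
  -- the side of the hyperplane through the radical circle on which the lens is less curved
  obtain ⟨u, hu, hsub⟩ : ∃ u : V, ‖u‖ = 1 ∧ ∀ v ∈ ballSlab u h' 0 τ,
      (ρ ^ 2 / R ^ 2) • x + v ∈ closedBall x r ∩ closedBall 0 ρ := by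
    have mem_of : ∀ v : V,
        ‖v‖ ^ 2 ≤ h ^ 2 - 2 * (ρ ^ 2 / R ^ 2) * (s * inner ℝ e v) →
        ‖v‖ ^ 2 ≤ h ^ 2 + 2 * (r ^ 2 / R ^ 2) * (s * inner ℝ e v) →
        (ρ ^ 2 / R ^ 2) • x + v ∈ closedBall x r ∩ closedBall 0 ρ := by
      intro v h1 h2
      have hxv : inner ℝ x v = s * inner ℝ e v := by
        conv_lhs => rw [hxe]
        rw [inner_smul_left]; simp
      have hhsq : h ^ 2 = r ^ 2 * ρ ^ 2 / R ^ 2 := by rw [hh_def]; ring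
      have hsR : s ^ 2 ≤ R ^ 2 := by gcongr
      constructor
      · rw [mem_closedBall, dist_eq_norm]
        apply le_of_sq_le_sq _ hr.le
        have : (ρ ^ 2 / R ^ 2) • x + v - x = v - (r ^ 2 / R ^ 2) • x := by
          have : ρ ^ 2 / R ^ 2 = 1 - r ^ 2 / R ^ 2 := by rw [hρ2]; field_simp
          rw [this, sub_smul, one_smul]; abel
        rw [this, norm_sub_sq_real, inner_smul_right, norm_smul, real_inner_comm, hxv]
        have e3 : (‖r ^ 2 / R ^ 2‖ * ‖x‖) ^ 2 ≤ r ^ 4 / R ^ 2 := by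
          rw [mul_pow, Real.norm_eq_abs, sq_abs, ← hs_def]
          calc (r ^ 2 / R ^ 2) ^ 2 * s ^ 2 ≤ (r ^ 2 / R ^ 2) ^ 2 * R ^ 2 := by gcongr
            _ = r ^ 4 / R ^ 2 := by field_simp
        have e4 : r ^ 2 * ρ ^ 2 / R ^ 2 + r ^ 4 / R ^ 2 = r ^ 2 := by
          rw [hρ2]; field_simp; ring
        linarith
      · rw [mem_closedBall_zero_iff]
        apply le_of_sq_le_sq _ hρ.le
        rw [norm_add_sq_real, inner_smul_left, norm_smul, hxv]
        simp only [conj_trivial]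
        have e3 : (‖ρ ^ 2 / R ^ 2‖ * ‖x‖) ^ 2 ≤ ρ ^ 4 / R ^ 2 := by
          rw [mul_pow, Real.norm_eq_abs, sq_abs, ← hs_def]
          calc (ρ ^ 2 / R ^ 2) ^ 2 * s ^ 2 ≤ (ρ ^ 2 / R ^ 2) ^ 2 * R ^ 2 := by gcongr
            _ = ρ ^ 4 / R ^ 2 := by field_simp
        have e4 : r ^ 2 * ρ ^ 2 / R ^ 2 + ρ ^ 4 / R ^ 2 = ρ ^ 2 := by
          rw [← add_div, div_eq_iff (by positivity)]
          linear_combination ρ ^ 2 * hρ2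
        linarith
    have coef : ∀ c : ℝ, 0 ≤ c → c ≤ r → c ≤ ρ → ∀ a : ℝ, 0 ≤ a → a ≤ τ →
        2 * (c ^ 2 / R ^ 2) * (s * a) ≤ 2 * τ * h := by
      intro c hc hcr hcρ a ha haτ
      have h1 : c ^ 2 / R ^ 2 * s ≤ h := by
        rw [hh_def, div_mul_eq_mul_div, div_le_div_iff₀ (by positivity) hR]
        have : c ^ 2 ≤ r * ρ := by rw [sq]; exact mul_le_mul hcr hcρ hc hr.le
        calc c ^ 2 * s * R ≤ (r * ρ) * R * R := by gcongr
          _ = r * ρ * R ^ 2 := by ring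
      calc 2 * (c ^ 2 / R ^ 2) * (s * a) = 2 * a * (c ^ 2 / R ^ 2 * s) := by ring
        _ ≤ 2 * τ * h := by gcongr
    rcases le_total r ρ with hle | hle
    · refine ⟨-e, by rw [norm_neg, he], fun v hv => ?_⟩
      obtain ⟨v1, v2, v3⟩ := hv
      rw [inner_neg_left] at v2 v3
      have hv2 : ‖v‖ ^ 2 ≤ h' ^ 2 := by gcongr
      have c1 := coef r hr.le le_rfl hle _ v2 v3
      have c2 : 0 ≤ 2 * (ρ ^ 2 / R ^ 2) * (s * -inner ℝ e v) := by positivity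
      have c3 : 0 ≤ τ * h := by positivity
      apply mem_of <;> linarith
    · refine ⟨e, he, fun v hv => ?_⟩
      obtain ⟨v1, v2, v3⟩ := hv
      have hv2 : ‖v‖ ^ 2 ≤ h' ^ 2 := by gcongr
      have c1 := coef ρ hρ.le hle le_rfl _ v2 v3
      have c2 : 0 ≤ 2 * (r ^ 2 / R ^ 2) * (s * inner ℝ e v) := by positivity
      have c3 : 0 ≤ τ * h := by positivity
      apply mem_of <;> linarith
  have hfin : ∀ (c : V) (a : ℝ), ν (closedBall c a) ≠ ⊤ := fun c a => measure_closedBall_lt_top.ne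
  have step1 : ν.real (ballSlab u h' 0 τ) ≤ ν.real (closedBall x r ∩ closedBall 0 ρ) := by
    apply ENNReal.toReal_mono (ne_top_of_le_ne_top (hfin 0 ρ) (measure_mono inter_subset_right))
    rw [← measure_preimage_add ν ((ρ ^ 2 / R ^ 2) • x) (closedBall x r ∩ closedBall 0 ρ)]
    exact measure_mono hsub
  have step2 : ν.real (closedBall 0 h') ≤ 8 * d * ν.real (ballSlab u h' 0 τ) := by
    have := measure_closedBall_le_ballSlab ν hu (R := h') hτ (N := 4 * d) (by omega) (by
      push_cast
      rw [hτ_def, mul_div_cancel₀ _ (by positivity)]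
      exact hh'h)
    have hslab := ne_top_of_le_ne_top (hfin 0 h') (measure_mono (μ := ν) (ballSlab_subset u h' 0 τ))
    have := ENNReal.toReal_mono (ENNReal.mul_ne_top (ENNReal.natCast_ne_top _) hslab) this
    rw [ENNReal.toReal_mul] at this
    refine this.trans (le_of_eq ?_)
    simp only [ENNReal.toReal_natCast, Measure.real]
    push_cast; ring
  have vol : ∀ a : ℝ, 0 ≤ a → ν.real (closedBall 0 a) = a ^ d * ν.real (ball 0 1) := by
    intro a ha
    rw [Measure.real, Measure.addHaar_closedBall ν 0 ha, ENNReal.toReal_mul,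
      ENNReal.toReal_ofReal (by positivity)]
    rfl
  have step3 : h ^ d / 2 ≤ h' ^ d := by
    rw [hh'_def, mul_pow]
    have := one_add_mul_le_pow (a := -(1 / (2 * (d : ℝ)))) (by linarith) d
    have e1 : 1 + (d : ℝ) * -(1 / (2 * d)) = 1 / 2 := by field_simp; norm_num
    rw [e1, ← sub_eq_add_neg] at this
    have := mul_le_mul_of_nonneg_left this (pow_nonneg hh.le d)
    linarith
  have e5 : (r / R) ^ d * ρ ^ d = h ^ d := by rw [← mul_pow, hh_def]; congr 1; ring
  rw [vol ρ hρ.le]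
  rw [vol h' hh'0] at step2
  have hb : 0 ≤ ν.real (ball (0 : V) 1) := measureReal_nonneg
  have e6 : (r / R) ^ d / (16 * d) * (ρ ^ d * ν.real (ball 0 1)) =
      (h ^ d / 2 * ν.real (ball 0 1)) / (8 * d) := by rw [← e5]; field_simp; ring
  rw [e6, div_le_iff₀ (by positivity)]
  have := mul_le_mul_of_nonneg_right step3 hb
  nlinarith

/-- Averaging: if every point of a finite set `X` lies within distance `r` of a large part of a
ball, then some point of the ball is within distance `r` of a large part of `X`. -/
lemma exists_card_le_card_filter (ν : Measure V) [ν.IsAddHaarMeasure] {r ρ p : ℝ} (hρ : 0 < ρ)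
    (X : Finset V)
    (hX : ∀ x ∈ X, p * ν.real (closedBall 0 ρ) ≤ ν.real (closedBall x r ∩ closedBall 0 ρ)) :
    ∃ y : V, p * X.card ≤ ((X.filter fun x => dist x y ≤ r).card : ℝ) := by
  classical
  have hfin : ν (closedBall (0 : V) ρ) ≠ ⊤ := measure_closedBall_lt_top.ne
  have hpos : 0 < ν (closedBall (0 : V) ρ) := measure_closedBall_pos ν 0 hρ
  have hpos' : 0 < ν.real (closedBall (0 : V) ρ) := ENNReal.toReal_pos hpos.ne' hfin
  have hint : ∀ x ∈ X, IntegrableOn ((closedBall x r).indicator fun _ => (1 : ℝ))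
      (closedBall (0 : V) ρ) ν := fun x _ =>
    (integrableOn_const (C := (1 : ℝ)) hfin).indicator isClosed_closedBall.measurableSet
  obtain ⟨y, -, hy⟩ := exists_setAverage_le (f := fun y => ∑ x ∈ X,
    (closedBall x r).indicator (fun _ => (1 : ℝ)) y) hpos.ne' hfin (integrable_finsetSum _ hint)
  refine ⟨y, ?_⟩
  have e1 : (∑ x ∈ X, (closedBall x r).indicator (fun _ => (1 : ℝ)) y) =
      ((X.filter fun x => dist x y ≤ r).card : ℝ) := by
    rw [Finset.card_filter]
    push_cast
    refine Finset.sum_congr rfl fun x _ => ?_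
    rw [Set.indicator_apply, mem_closedBall, dist_comm]
  rw [e1] at hy
  refine le_trans ?_ hy
  rw [setAverage_eq, integral_finsetSum _ hint, smul_eq_mul, inv_mul_eq_div, le_div_iff₀ hpos']
  calc p * X.card * ν.real (closedBall 0 ρ) = ∑ x ∈ X, p * ν.real (closedBall 0 ρ) := by
        rw [Finset.sum_const, nsmul_eq_mul]; ring
    _ ≤ _ := Finset.sum_le_sum fun x hx => ?_
  refine (hX x hx).trans (le_of_eq ?_)
  rw [integral_indicator isClosed_closedBall.measurableSet]
  simp [Measure.real, Measure.restrict_apply isClosed_closedBall.measurableSet]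

/-- Greedy covering: iterating the averaging step leaves at most the fraction `(1 - p) ^ k` of the
finite set uncovered. -/
lemma exists_greedy_cover (ν : Measure V) [ν.IsAddHaarMeasure] {r ρ p : ℝ} (hρ : 0 < ρ)
    (hp : p ≤ 1) (X : Finset V)
    (hX : ∀ x ∈ X, p * ν.real (closedBall 0 ρ) ≤ ν.real (closedBall x r ∩ closedBall 0 ρ))
    (k : ℕ) :
    ∃ T : Finset V, T.card ≤ k ∧
      ((X.filter fun x => ∀ y ∈ T, r < dist x y).card : ℝ) ≤ (1 - p) ^ k * X.card := by
  classical
  induction k with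
  | zero => exact ⟨∅, by simp⟩
  | succ k ih =>
    obtain ⟨T, hT, hc⟩ := ih
    set Y := X.filter fun x => ∀ y ∈ T, r < dist x y with hY
    obtain ⟨y, hy⟩ := exists_card_le_card_filter ν hρ Y
      (fun x hx => hX x (Finset.filter_subset _ _ hx))
    refine ⟨insert y T, (Finset.card_insert_le _ _).trans (by omega), ?_⟩
    have hsplit := Finset.card_filter_add_card_filter_not (s := Y) (fun x => dist x y ≤ r)
    have hEq : (X.filter fun x => ∀ z ∈ insert y T, r < dist x z) =
        Y.filter fun x => ¬ dist x y ≤ r := by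
      ext x
      simp only [hY, Finset.mem_filter, Finset.mem_insert, forall_eq_or_imp, not_le]
      tauto
    rw [hEq]
    have h2 : ((Y.filter fun x => dist x y ≤ r).card : ℝ) +
        (Y.filter fun x => ¬ dist x y ≤ r).card = Y.card := by exact_mod_cast hsplit
    calc ((Y.filter fun x => ¬ dist x y ≤ r).card : ℝ) ≤ (1 - p) * Y.card := by linarith
      _ ≤ (1 - p) * ((1 - p) ^ k * X.card) := by
          apply mul_le_mul_of_nonneg_left hc; linarith
      _ = _ := by ring

/-- The volume bound for nets: disjoint balls of radius `η / 2` around the points of a maximal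
`η`-separated set fit into `D`. -/
lemma exists_net_of_volume (ν : Measure V) [ν.IsAddHaarMeasure] {η : ℝ} (hη : 0 < η)
    {A D : Set V} (hD : ν D ≠ ⊤) (hAD : ∀ x ∈ A, ball x (η / 2) ⊆ D) :
    ∃ T : Finset V, (∀ y ∈ T, y ∈ A) ∧ (∀ x ∈ A, ∃ y ∈ T, dist x y ≤ η) ∧
      T.card * ν.real (ball 0 (η / 2)) ≤ ν.real D := by
  classical
  have hbfin : ν (ball (0 : V) (η / 2)) ≠ ⊤ := measure_ball_lt_top.ne
  have hb : 0 < ν.real (ball (0 : V) (η / 2)) :=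
    ENNReal.toReal_pos (measure_ball_pos ν 0 (by positivity)).ne' hbfin
  let P : Finset V → Prop := fun T =>
    (∀ y ∈ T, y ∈ A) ∧ (T : Set V).Pairwise fun x y => η < dist x y
  have hbound : ∀ T, P T → T.card * ν.real (ball 0 (η / 2)) ≤ ν.real D := by
    intro T ⟨hTA, hTs⟩
    have hdisj : (T : Set V).PairwiseDisjoint fun x => ball x (η / 2) := by
      intro x hx y hy hxy
      apply ball_disjoint_ball
      have := hTs hx hy hxy
      linarith
    have h1 := measure_biUnion_finset (μ := ν) hdisj fun x _ => isOpen_ball.measurableSet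
    have h2 : ν (⋃ x ∈ T, ball x (η / 2)) ≤ ν D :=
      measure_mono (iUnion₂_subset fun x hx => hAD x (hTA x hx))
    simp only [Measure.addHaar_ball_center] at h1
    rw [h1, Finset.sum_const, nsmul_eq_mul] at h2
    have := ENNReal.toReal_mono hD h2
    rw [ENNReal.toReal_mul] at this
    simpa [Measure.real] using this
  obtain ⟨T, hT, hmax⟩ : ∃ T, P T ∧ ∀ T', P T' → T'.card ≤ T.card := by
    have hne : {n | ∃ T, P T ∧ T.card = n}.Nonempty :=
      ⟨0, ∅, ⟨by simp, by simp⟩, rfl⟩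
    have hbdd : BddAbove {n | ∃ T, P T ∧ T.card = n} := by
      refine ⟨⌊ν.real D / ν.real (ball (0 : V) (η / 2))⌋₊, ?_⟩
      rintro n ⟨T, hT, rfl⟩
      apply Nat.le_floor
      rw [le_div_iff₀ hb]
      exact hbound T hT
    obtain ⟨T, hT, hc⟩ := Nat.sSup_mem hne hbdd
    exact ⟨T, hT, fun T' hT' => hc ▸ le_csSup hbdd ⟨T', hT', rfl⟩⟩
  refine ⟨T, hT.1, fun x hx => ?_, hbound T hT⟩
  by_contra! hcon
  have hxT : x ∉ T := fun hxT => by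
    have := hcon x hxT
    rw [dist_self] at this
    linarith
  have := hmax (insert x T) ⟨by simpa [hx] using hT.1, by
    rw [Finset.coe_insert]
    refine hT.2.insert fun y hy _ => ⟨hcon y hy, by rw [dist_comm]; exact hcon y hy⟩⟩
  rw [Finset.card_insert_of_notMem hxT] at this
  omega

/-- **Economical covering of a ball by balls.** In dimension `d` a ball of radius `R` is covered by
`(R / r) ^ d` balls of radius `r ≤ R`, up to a factor polynomial in `d` and logarithmic in
`R / r`. -/
theorem exists_ball_cover (hd : 0 < finrank ℝ V) {r R : ℝ} (hr : 0 < r) (hrR : r ≤ R) :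
    ∃ T : Finset V, (∀ x : V, ‖x‖ ≤ R → ∃ y ∈ T, dist x y ≤ r) ∧
      (T.card : ℝ) ≤
        245 * (finrank ℝ V : ℝ) ^ 3 * (1 + Real.log (R / r)) * (R / r) ^ finrank ℝ V := by
  classical
  set d := finrank ℝ V with hd_def
  let ν : Measure V := volume
  have hd1 : (1 : ℝ) ≤ d := by exact_mod_cast hd
  have hR : 0 < R := hr.trans_le hrR
  set κ := R / r with hκ_def
  have hκ : 1 ≤ κ := by rw [hκ_def, one_le_div hr]; exact hrR
  set η := r / (d + 1) with hη_def
  have hη : 0 < η := by positivity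
  set r₀ := r * d / (d + 1) with hr₀_def
  have hr₀ : 0 < r₀ := by positivity
  have hr₀η : r₀ + η = r := by rw [hr₀_def, hη_def]; field_simp
  have hr₀R : r₀ < R := by linarith
  set b := 5 * d * κ with hb_def
  have hdκ : 1 ≤ d * κ := by nlinarith
  have hb5 : 5 ≤ b := by rw [hb_def]; linarith
  have hlogb : 1 ≤ Real.log b := by
    rw [Real.le_log_iff_exp_le (by linarith)]
    linarith [Real.exp_one_lt_d9]
  -- a fine net of the ball
  obtain ⟨X, hXA, hXnet, hXcard⟩ := exists_net_of_volume ν hη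
    (A := closedBall (0 : V) R) (D := closedBall (0 : V) (R + η / 2)) measure_closedBall_lt_top.ne
    (fun x hx y hy => by
      rw [mem_closedBall_zero_iff] at hx ⊢
      rw [mem_ball, dist_eq_norm] at hy
      have := norm_le_norm_add_norm_sub' y x
      linarith)
  have hXb : (X.card : ℝ) ≤ b ^ d := by
    have hb1 : 0 < ν.real (ball (0 : V) 1) :=
      ENNReal.toReal_pos (measure_ball_pos ν 0 one_pos).ne' measure_ball_lt_top.ne
    rw [Measure.real, Measure.real, Measure.addHaar_ball_of_pos ν 0 (by positivity),
      Measure.addHaar_closedBall ν 0 (by positivity), ENNReal.toReal_mul, ENNReal.toReal_mul,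
      ENNReal.toReal_ofReal (by positivity), ENNReal.toReal_ofReal (by positivity),
      ← mul_assoc] at hXcard
    have h1 := le_of_mul_le_mul_right hXcard hb1
    rw [← le_div_iff₀ (by positivity), ← div_pow] at h1
    refine h1.trans ?_
    gcongr
    have : (R + η / 2) / (η / 2) = 1 + 2 * (d + 1) * κ := by
      rw [hη_def, hκ_def]; field_simp; ring
    rw [this, hb_def]
    nlinarith
  set p := (r₀ / R) ^ d / (16 * d) with hp_def
  have hp : 0 < p := by positivity
  have hp1 : p ≤ 1 := by
    rw [hp_def, div_le_one (by positivity)]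
    have : (r₀ / R) ^ d ≤ 1 := pow_le_one₀ (by positivity) ((div_le_one hR).2 hr₀R.le)
    linarith
  set k := ⌊d * Real.log b / p⌋₊ + 1 with hk_def
  obtain ⟨T, hTk, hT⟩ := exists_greedy_cover ν (r := r₀)
    (Real.sqrt_pos.2 (by nlinarith : 0 < R ^ 2 - r₀ ^ 2)) hp1 X
    (fun x hx => measure_lens_ge ν hd hr₀ hr₀R (by simpa using hXA x hx)) k
  have hk1 : d * Real.log b / p < k := by
    rw [hk_def]; push_cast; exact Nat.lt_floor_add_one _
  have hlt : ((X.filter fun x => ∀ y ∈ T, r₀ < dist x y).card : ℝ) < 1 := by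
    refine hT.trans_lt ?_
    have h1 : (1 - p) ^ k ≤ Real.exp (-(p * k)) := by
      rw [show -(p * k) = (k : ℕ) * (-p) by ring, Real.exp_nat_mul]
      have := Real.add_one_le_exp (-p)
      exact pow_le_pow_left₀ (by linarith) (by linarith) _
    have h2 : b ^ d = Real.exp (d * Real.log b) := by
      rw [Real.exp_nat_mul, Real.exp_log (by linarith)]
    calc (1 - p) ^ k * (X.card : ℝ) ≤ Real.exp (-(p * k)) * Real.exp (d * Real.log b) := by
          rw [← h2]; gcongr
      _ < 1 := by
          rw [← Real.exp_add, Real.exp_lt_one_iff]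
          rw [div_lt_iff₀ hp] at hk1
          linarith
  have hempty : (X.filter fun x => ∀ y ∈ T, r₀ < dist x y) = ∅ := by
    rw [← Finset.card_eq_zero]
    exact Nat.lt_one_iff.1 (by exact_mod_cast hlt)
  refine ⟨T, fun x hx => ?_, ?_⟩
  · obtain ⟨z, hz, hxz⟩ := hXnet x (by simpa using hx)
    have := Finset.filter_eq_empty_iff.1 hempty hz
    push Not at this
    obtain ⟨y, hy, hzy⟩ := this
    exact ⟨y, hy, (dist_triangle x z y).trans (by linarith)⟩
  · have hkle : (k : ℝ) ≤ d * Real.log b / p + 1 := by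
      rw [hk_def]; push_cast
      have := Nat.floor_le (a := d * Real.log b / p) (by positivity)
      linarith
    have hinv : 1 / p ≤ 48 * d * κ ^ d := by
      have e1 : 1 / p = 16 * d * (κ ^ d * (1 + 1 / d) ^ d) := by
        rw [hp_def, ← mul_pow]
        have : κ * (1 + 1 / d) = (r₀ / R)⁻¹ := by
          rw [hκ_def, hr₀_def]; field_simp
        rw [this, inv_pow]; field_simp
      have e2 : (1 + 1 / (d : ℝ)) ^ d ≤ 3 := by
        calc (1 + 1 / (d : ℝ)) ^ d ≤ Real.exp (1 / d) ^ d := by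
              have := Real.add_one_le_exp (1 / (d : ℝ))
              exact pow_le_pow_left₀ (by positivity) (by linarith) _
          _ = Real.exp 1 := by rw [← Real.exp_nat_mul]; congr 1; field_simp
          _ ≤ 3 := by linarith [Real.exp_one_lt_d9]
      rw [e1]
      calc 16 * (d : ℝ) * (κ ^ d * (1 + 1 / d) ^ d) ≤ 16 * d * (κ ^ d * 3) := by gcongr
        _ = _ := by ring
    have hκd : 1 ≤ κ ^ d := one_le_pow₀ hκ
    have hlogb2 : Real.log b ≤ 5 * d * (1 + Real.log κ) := by
      rw [hb_def, Real.log_mul (by positivity) (by positivity)]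
      have h1 := Real.log_le_sub_one_of_pos (show (0 : ℝ) < 5 * d by positivity)
      have h2 := Real.log_nonneg hκ
      nlinarith
    have hone : 1 ≤ (d : ℝ) ^ 2 * Real.log b * κ ^ d := by
      have : 1 ≤ (d : ℝ) ^ 2 := one_le_pow₀ hd1
      exact one_le_mul_of_one_le_of_one_le (one_le_mul_of_one_le_of_one_le this hlogb) hκd
    calc (T.card : ℝ) ≤ k := by exact_mod_cast hTk
      _ ≤ d * Real.log b * (1 / p) + 1 := by rw [mul_one_div]; exact hkle
      _ ≤ d * Real.log b * (48 * d * κ ^ d) + 1 := by gcongr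
      _ ≤ 49 * (d ^ 2 * κ ^ d) * Real.log b := by nlinarith
      _ ≤ 49 * (d ^ 2 * κ ^ d) * (5 * d * (1 + Real.log κ)) := by gcongr
      _ = _ := by ring

end BallCovering

/-! ### Sequences, finitely many coordinates, and volumes of ellipsoids -/

section Coordinates

lemma mem_ellipsoid_iff {μ : ℕ → ℝ} (hμ : ∀ n, 0 ≤ μ n) {x : L2} :
    x ∈ ellipsoid μ ↔ (∀ n, μ n = 0 → x n = 0) ∧ ∀ F : Finset ℕ, ∑ n ∈ F, (x n / μ n) ^ 2 ≤ 1 := by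
  classical
  refine and_congr_right fun _ => ?_
  simp only [sq_abs]
  constructor
  · intro h F
    have h1 := (ENNReal.sum_le_tsum (F.subtype fun n => 0 < μ n)).trans h
    rw [← ENNReal.ofReal_sum_of_nonneg fun _ _ => sq_nonneg _, ← ENNReal.ofReal_one,
      ENNReal.ofReal_le_ofReal_iff zero_le_one,
      Finset.sum_subtype_eq_sum_filter (f := fun n => (x n / μ n) ^ 2)] at h1
    refine le_trans (le_of_eq ?_) h1
    rw [Finset.sum_filter]
    refine Finset.sum_congr rfl fun n _ => ?_
    rcases (hμ n).eq_or_lt with h0 | h0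
    · simp [← h0]
    · simp [h0]
  · intro h
    rw [ENNReal.tsum_eq_iSup_sum]
    refine iSup_le fun s => ?_
    rw [← ENNReal.ofReal_sum_of_nonneg fun _ _ => sq_nonneg _, ← ENNReal.ofReal_one]
    apply ENNReal.ofReal_le_ofReal
    have := h (s.map (Function.Embedding.subtype _))
    rwa [Finset.sum_map] at this

lemma dist_le_of_forall_sum_le {x y : L2} {ε : ℝ} (hε : 0 ≤ ε)
    (h : ∀ F : Finset ℕ, ∑ n ∈ F, (x n - y n) ^ 2 ≤ ε ^ 2) : dist x y ≤ ε := by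
  rw [dist_eq_norm]
  apply lp.norm_le_of_forall_sum_le (by simp) hε
  intro F
  have := h F
  simpa using this

lemma sum_sub_sq_le_dist_sq (x y : L2) (F : Finset ℕ) :
    ∑ n ∈ F, (x n - y n) ^ 2 ≤ dist x y ^ 2 := by
  rw [dist_eq_norm]
  have := lp.sum_rpow_le_norm_rpow (p := 2) (by simp) (x - y) F
  simpa using this

/-- The point of `ℓ²` that agrees with `c` on the finite set `S` and vanishes elsewhere. -/
noncomputable def truncate (S : Finset ℕ) (c : ℕ → ℝ) : L2 :=
  ⟨fun n => if n ∈ S then c n else 0, memℓp_gen (summable_of_ne_finset_zero (s := S) fun n hn => by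
    simp [hn])⟩

lemma truncate_apply (S : Finset ℕ) (c : ℕ → ℝ) (n : ℕ) :
    truncate S c n = if n ∈ S then c n else 0 := rfl

lemma zero_mem_ellipsoid (μ : ℕ → ℝ) : (0 : L2) ∈ ellipsoid μ := by
  simp [ellipsoid]

lemma isCover_iff {ε : ℝ} (hε : 0 ≤ ε) {A C : Set L2} :
    IsCover ε.toNNReal A C ↔ ∀ x ∈ A, ∃ y ∈ C, dist x y ≤ ε := by
  simp [IsCover, SetRel.IsCover, edist_dist, ENNReal.ofReal, hε]

lemma metricEntropy_le {ε : ℝ} (hε : 0 ≤ ε) {A : Set L2} (hA : A.Nonempty) (T : Finset L2)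
    (hT : ∀ x ∈ A, ∃ y ∈ T, dist x y ≤ ε) : metricEntropy ε A ≤ Real.log T.card := by
  have h1 : externalCoveringNumber ε.toNNReal A ≤ (T.card : ℕ∞) := by
    rw [← Set.encard_coe_eq_coe_finsetCard]
    exact IsCover.externalCoveringNumber_le_encard ((isCover_iff hε).2 (by simpa using hT))
  have h2 : 0 < externalCoveringNumber ε.toNNReal A := externalCoveringNumber_pos_iff.2 hA
  have h3 := ne_top_of_le_ne_top (ENat.natCast_ne_top _) h1
  have h4 := ENat.toNat_le_of_le_natCast h1
  have h5 : 0 < (externalCoveringNumber ε.toNNReal A).toNat := by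
    rw [Nat.pos_iff_ne_zero]
    intro h0
    rw [ENat.toNat_eq_zero] at h0
    rcases h0 with h0 | h0
    · exact h2.ne' h0
    · exact h3 h0
  exact Real.log_le_log (by exact_mod_cast h5) (by exact_mod_cast h4)

lemma le_metricEntropy {ε : ℝ} (hε : 0 ≤ ε) {A : Set L2} {b : ℝ} (hb : 0 < b)
    (hfin : ∃ T : Finset L2, ∀ x ∈ A, ∃ y ∈ T, dist x y ≤ ε)
    (h : ∀ T : Finset L2, (∀ x ∈ A, ∃ y ∈ T, dist x y ≤ ε) → b ≤ T.card) :
    Real.log b ≤ metricEntropy ε A := by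
  have h1 : ((⌈b⌉₊ : ℕ) : ℕ∞) ≤ externalCoveringNumber ε.toNNReal A := by
    refine le_iInf₂ fun C hC => ?_
    rcases C.finite_or_infinite with hf | hf
    · obtain ⟨T, rfl⟩ := hf.exists_finset_coe
      rw [Set.encard_coe_eq_coe_finsetCard]
      exact_mod_cast Nat.ceil_le.2 (h T (by simpa using (isCover_iff hε).1 hC))
    · rw [hf.encard_eq]; exact le_top
  have h3 : externalCoveringNumber ε.toNNReal A ≠ ⊤ := by
    obtain ⟨T, hT⟩ := hfin
    refine ne_top_of_le_ne_top (ENat.natCast_ne_top T.card) ?_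
    rw [← Set.encard_coe_eq_coe_finsetCard]
    exact IsCover.externalCoveringNumber_le_encard ((isCover_iff hε).2 (by simpa using hT))
  have h4 := ENat.toNat_le_toNat h1 h3
  rw [ENat.toNat_natCast] at h4
  apply Real.log_le_log hb
  exact (Nat.le_ceil b).trans (by exact_mod_cast h4)

/-- Restriction of a sequence to the coordinates in `s`. -/
noncomputable def restrictTo (s : Finset ℕ) (x : ℕ → ℝ) : EuclideanSpace ℝ s :=
  WithLp.toLp 2 fun n => x n

/-- Extension by zero of a vector indexed by `s`. -/
noncomputable def extendZero (s : Finset ℕ) (y : EuclideanSpace ℝ s) : ℕ → ℝ :=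
  fun n => if h : n ∈ s then y ⟨n, h⟩ else 0

lemma restrictTo_extendZero (s : Finset ℕ) (y : EuclideanSpace ℝ s) :
    restrictTo s (extendZero s y) = y := by
  ext n
  simp [restrictTo, extendZero]

lemma norm_restrictTo_sq (s : Finset ℕ) (x : ℕ → ℝ) : ‖restrictTo s x‖ ^ 2 = ∑ n ∈ s, x n ^ 2 := by
  rw [EuclideanSpace.real_norm_sq_eq]
  exact Finset.sum_coe_sort s fun n => x n ^ 2

lemma dist_restrictTo_sq (s : Finset ℕ) (x : ℕ → ℝ) (y : ℕ → ℝ) :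
    dist (restrictTo s x) (restrictTo s y) ^ 2 = ∑ n ∈ s, (x n - y n) ^ 2 := by
  rw [dist_eq_norm]
  exact norm_restrictTo_sq s (fun n => x n - y n)

/-- The economical covering of balls in terms of finitely many coordinates. -/
lemma exists_ball_cover_coord (s : Finset ℕ) {r R m : ℝ} (hr : 0 < r) (hrR : r ≤ R) (hm : 1 ≤ m)
    (hsm : s.card ≤ m) :
    ∃ T : Finset (ℕ → ℝ), T.Nonempty ∧
      (∀ x : ℕ → ℝ, ∑ n ∈ s, x n ^ 2 ≤ R ^ 2 → ∃ c ∈ T, ∑ n ∈ s, (x n - c n) ^ 2 ≤ r ^ 2) ∧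
      (T.card : ℝ) ≤ 245 * m ^ 3 * (1 + Real.log (R / r)) * (R / r) ^ s.card := by
  classical
  have hlog : 0 ≤ Real.log (R / r) := Real.log_nonneg ((one_le_div hr).2 hrR)
  have hR : 0 < R := hr.trans_le hrR
  rcases s.eq_empty_or_nonempty with rfl | hs
  · refine ⟨{0}, by simp, by simp [sq_nonneg], ?_⟩
    have : 1 ≤ m ^ 3 := one_le_pow₀ hm
    simp only [Finset.card_singleton, Finset.card_empty, pow_zero, mul_one, Nat.cast_one]
    nlinarith
  · have hd : 0 < finrank ℝ (EuclideanSpace ℝ s) := by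
      rw [finrank_euclideanSpace, Fintype.card_coe]; exact hs.card_pos
    obtain ⟨T, hT, hc⟩ := exists_ball_cover hd hr hrR
    rw [finrank_euclideanSpace, Fintype.card_coe] at hc
    refine ⟨T.image (extendZero s), ?_, fun x hx => ?_, ?_⟩
    · obtain ⟨y, hy, -⟩ := hT 0 (by simpa using hR.le)
      exact ⟨_, Finset.mem_image_of_mem _ hy⟩
    · obtain ⟨y, hy, hxy⟩ := hT (restrictTo s x) (by
        apply le_of_sq_le_sq _ hR.le
        rwa [norm_restrictTo_sq])
      refine ⟨_, Finset.mem_image_of_mem _ hy, ?_⟩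
      rw [← dist_restrictTo_sq, restrictTo_extendZero]
      gcongr
    · refine le_trans (by exact_mod_cast Finset.card_image_le) (hc.trans ?_)
      gcongr

variable {μ : ℕ → ℝ} {s : Finset ℕ}

/-- The diagonal linear map with entries `μ n`, which sends the unit ball to the ellipsoid in the
coordinates `s`. -/
noncomputable def diagMap (μ : ℕ → ℝ) (s : Finset ℕ) :
    EuclideanSpace ℝ s →ₗ[ℝ] EuclideanSpace ℝ s :=
  Matrix.toLpLin 2 2 (Matrix.diagonal fun n : s => μ n)

lemma diagMap_restrictTo (x : ℕ → ℝ) :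
    diagMap μ s (restrictTo s x) = restrictTo s fun n => μ n * x n := by
  ext n
  simp [diagMap, restrictTo, Matrix.toLpLin_apply, Matrix.mulVec_diagonal]

lemma det_diagMap : LinearMap.det (diagMap μ s) = ∏ n ∈ s, μ n := by
  rw [diagMap, Matrix.toLpLin_eq_toLin, LinearMap.det_toLin, Matrix.det_diagonal]
  exact Finset.prod_coe_sort s fun n => μ n

lemma restrictTo_mem_image_diagMap (hs : ∀ n ∈ s, 0 < μ n) {a : ℝ} (ha : 0 ≤ a) (x : ℕ → ℝ) :
    restrictTo s x ∈ diagMap μ s '' closedBall 0 a ↔ ∑ n ∈ s, (x n / μ n) ^ 2 ≤ a ^ 2 := by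
  have key : diagMap μ s (restrictTo s fun n => x n / μ n) = restrictTo s x := by
    rw [diagMap_restrictTo]
    ext n
    simp only [restrictTo]
    exact mul_div_cancel₀ _ (hs n n.2).ne'
  constructor
  · rintro ⟨y, hy, hyx⟩
    have hinj : Function.Injective (diagMap μ s) := by
      have : IsUnit (LinearMap.det (diagMap μ s)) := by
        rw [det_diagMap, isUnit_iff_ne_zero]
        exact (Finset.prod_pos hs).ne'
      exact ((Module.End.isUnit_iff _).1 ((LinearMap.isUnit_iff_isUnit_det _).2 this)).1
    rw [← key] at hyx
    rw [hinj hyx, mem_closedBall_zero_iff] at hy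
    rw [← norm_restrictTo_sq]
    gcongr
  · intro h
    refine ⟨_, ?_, key⟩
    rw [mem_closedBall_zero_iff]
    apply le_of_sq_le_sq _ ha
    rwa [norm_restrictTo_sq]

lemma volume_image_diagMap (hs : ∀ n ∈ s, 0 < μ n) {a : ℝ} (ha : 0 ≤ a) :
    volume (diagMap μ s '' closedBall 0 a) =
      ENNReal.ofReal ((∏ n ∈ s, μ n) * a ^ s.card) * volume (ball (0 : EuclideanSpace ℝ s) 1) := by
  have hp := (Finset.prod_pos hs).le
  rw [Measure.addHaar_image_linearMap, det_diagMap, Measure.addHaar_closedBall _ _ ha,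
    finrank_euclideanSpace, Fintype.card_coe, abs_of_nonneg hp, ← mul_assoc, ENNReal.ofReal_mul hp]

lemma volume_real_ball_pos (s : Finset ℕ) :
    0 < (volume : Measure (EuclideanSpace ℝ s)).real (ball 0 1) :=
  ENNReal.toReal_pos (measure_ball_pos _ 0 one_pos).ne' measure_ball_lt_top.ne

/-- A net of a finite-dimensional ellipsoid all of whose semi-axes are at least `η`. -/
lemma exists_ellipsoid_net {η : ℝ} (hη : 0 < η) (hs : ∀ n ∈ s, η ≤ μ n) :
    ∃ T : Finset (ℕ → ℝ),
      (∀ x : ℕ → ℝ, ∑ n ∈ s, (x n / μ n) ^ 2 ≤ 1 → ∃ c ∈ T, ∑ n ∈ s, (x n - c n) ^ 2 ≤ η ^ 2) ∧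
      (T.card : ℝ) ≤ ∏ n ∈ s, (3 * μ n / η) := by
  classical
  have hs0 : ∀ n ∈ s, 0 < μ n := fun n hn => hη.trans_le (hs n hn)
  have hv := volume_image_diagMap hs0 (show (0 : ℝ) ≤ 3 / 2 by norm_num)
  have hp := (Finset.prod_pos hs0).le
  have hfin : volume (diagMap μ s '' closedBall 0 (3 / 2)) ≠ ⊤ := by
    rw [hv]; exact ENNReal.mul_ne_top ENNReal.ofReal_ne_top measure_ball_lt_top.ne
  obtain ⟨T, -, hT, hc⟩ := exists_net_of_volume (volume : Measure (EuclideanSpace ℝ s)) hη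
    (A := diagMap μ s '' closedBall 0 1) (D := diagMap μ s '' closedBall 0 (3 / 2)) hfin (by
      rintro _ ⟨x, hx, rfl⟩ z hz
      -- the ball of radius `η / 2` lies in the half-sized ellipsoid
      obtain ⟨w, hw, hwz⟩ : z - diagMap μ s x ∈ diagMap μ s '' closedBall 0 (1 / 2) := by
        rw [← restrictTo_extendZero s (z - diagMap μ s x),
          restrictTo_mem_image_diagMap hs0 (by norm_num)]
        rw [mem_ball, dist_eq_norm, ← restrictTo_extendZero s (z - diagMap μ s x)] at hz
        have h1 : ‖restrictTo s (extendZero s (z - diagMap μ s x))‖ ^ 2 ≤ (η / 2) ^ 2 := by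
          gcongr
        rw [norm_restrictTo_sq] at h1
        calc _ ≤ ∑ n ∈ s, extendZero s (z - diagMap μ s x) n ^ 2 / η ^ 2 := by
              refine Finset.sum_le_sum fun n hn => ?_
              rw [div_pow]
              gcongr
              exact hs n hn
          _ ≤ (η / 2) ^ 2 / η ^ 2 := by rw [← Finset.sum_div]; gcongr
          _ = (1 / 2) ^ 2 := by field_simp
      refine ⟨x + w, ?_, by rw [map_add, hwz]; abel⟩
      rw [mem_closedBall_zero_iff] at hx hw ⊢
      linarith [norm_add_le x w])
  refine ⟨T.image (extendZero s), fun x hx => ?_, ?_⟩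
  · obtain ⟨y, hy, hxy⟩ := hT (restrictTo s x) (by
      rw [restrictTo_mem_image_diagMap hs0 zero_le_one]; simpa using hx)
    refine ⟨_, Finset.mem_image_of_mem _ hy, ?_⟩
    rw [← dist_restrictTo_sq, restrictTo_extendZero]
    gcongr
  · refine le_trans (by exact_mod_cast Finset.card_image_le) (?_ : (T.card : ℝ) ≤ _)
    rw [Measure.real, Measure.real, hv, Measure.addHaar_ball_of_pos _ _ (by positivity), ENNReal.toReal_mul,
      ENNReal.toReal_mul, ENNReal.toReal_ofReal (by positivity),
      ENNReal.toReal_ofReal (by positivity), finrank_euclideanSpace, Fintype.card_coe,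
      ← mul_assoc] at hc
    have h1 := le_of_mul_le_mul_right hc (volume_real_ball_pos s)
    rw [← le_div_iff₀ (by positivity)] at h1
    refine h1.trans (le_of_eq ?_)
    rw [Finset.prod_div_distrib, Finset.prod_mul_distrib, Finset.prod_const, Finset.prod_const,
      div_pow, div_pow]
    field_simp

/-- The volume lower bound for coverings of a finite-dimensional ellipsoid. -/
lemma prod_le_card_of_cover {ε : ℝ} (hε : 0 < ε) (hs : ∀ n ∈ s, 0 < μ n) (T : Finset (ℕ → ℝ))
    (hT : ∀ x : ℕ → ℝ, ∑ n ∈ s, (x n / μ n) ^ 2 ≤ 1 → ∃ c ∈ T, ∑ n ∈ s, (x n - c n) ^ 2 ≤ ε ^ 2) :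
    ∏ n ∈ s, (μ n / ε) ≤ T.card := by
  have hv := volume_image_diagMap hs zero_le_one
  have hp := (Finset.prod_pos hs).le
  have hsub : diagMap μ s '' closedBall 0 1 ⊆ ⋃ c ∈ T, closedBall (restrictTo s c) ε := by
    intro y hy
    rw [← restrictTo_extendZero s y, restrictTo_mem_image_diagMap hs zero_le_one] at hy
    obtain ⟨c, hc, hyc⟩ := hT _ (by simpa using hy)
    simp only [mem_iUnion]
    refine ⟨c, hc, ?_⟩
    rw [mem_closedBall]
    apply le_of_sq_le_sq _ hε.le
    rwa [← restrictTo_extendZero s y, dist_restrictTo_sq]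
  have h1 := (measure_mono hsub).trans (measure_biUnion_finset_le (μ := volume) T _)
  simp only [Measure.addHaar_closedBall _ _ hε.le] at h1
  rw [hv, Finset.sum_const, nsmul_eq_mul, finrank_euclideanSpace, Fintype.card_coe] at h1
  have h2 := ENNReal.toReal_mono (ENNReal.mul_ne_top (ENNReal.natCast_ne_top _)
    (ENNReal.mul_ne_top ENNReal.ofReal_ne_top measure_ball_lt_top.ne)) h1
  rw [ENNReal.toReal_mul, ENNReal.toReal_mul, ENNReal.toReal_mul,
    ENNReal.toReal_ofReal (by positivity), ENNReal.toReal_ofReal (by positivity),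
    ENNReal.toReal_natCast, ← mul_assoc] at h2
  have h3 := le_of_mul_le_mul_right h2 (volume_real_ball_pos s)
  rw [Finset.prod_div_distrib, Finset.prod_const, div_le_iff₀ (by positivity)]
  simpa using h3

end Coordinates

/-! ### Entropy bounds for a fixed radius -/

section EntropyBounds

variable {μ : ℕ → ℝ}

/-- Control of the coordinates outside `S`: where the semi-axes are at most `ε`, the tail of a
point of the ellipsoid is controlled by its share of the defining sum. -/
lemma sum_sdiff_sq_le (hμ : ∀ n, 0 ≤ μ n) {x : L2} (hx : x ∈ ellipsoid μ) {S : Finset ℕ} {ε : ℝ}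
    (hS : ∀ n ∉ S, μ n ≤ ε) (F : Finset ℕ) :
    ∑ n ∈ F \ S, x n ^ 2 ≤ ε ^ 2 * ∑ n ∈ F \ S, (x n / μ n) ^ 2 := by
  rw [Finset.mul_sum]
  refine Finset.sum_le_sum fun n hn => ?_
  have hnS := hS n (Finset.mem_sdiff.1 hn).2
  rcases (hμ n).eq_or_lt with h0 | h0
  · rw [((mem_ellipsoid_iff hμ).1 hx).1 n h0.symm]; simp
  · calc x n ^ 2 = μ n ^ 2 * (x n / μ n) ^ 2 := by field_simp
      _ ≤ _ := by gcongr

/-- Approximation of a point of `ℓ²` by a truncated sequence splits into head and tail. -/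
lemma dist_truncate_le {x : L2} {S : Finset ℕ} {c : ℕ → ℝ} {ε : ℝ} (hε : 0 ≤ ε)
    (h : ∀ F : Finset ℕ, ∑ n ∈ S, (x n - c n) ^ 2 + ∑ n ∈ F \ S, x n ^ 2 ≤ ε ^ 2) :
    dist x (truncate S c) ≤ ε := by
  classical
  refine dist_le_of_forall_sum_le hε fun F => le_trans ?_ (h F)
  have h1 : ∑ n ∈ S, (x n - c n) ^ 2 = ∑ n ∈ S, (x n - truncate S c n) ^ 2 :=
    Finset.sum_congr rfl fun n hn => by rw [truncate_apply, if_pos hn]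
  have h2 : ∑ n ∈ F \ S, x n ^ 2 = ∑ n ∈ F \ S, (x n - truncate S c n) ^ 2 :=
    Finset.sum_congr rfl fun n hn => by
      rw [truncate_apply, if_neg (Finset.mem_sdiff.1 hn).2, sub_zero]
  rw [h1, h2, ← Finset.sum_union Finset.disjoint_sdiff, Finset.union_sdiff_self_eq_union]
  exact Finset.sum_le_sum_of_subset_of_nonneg Finset.subset_union_right fun _ _ _ => sq_nonneg _

/-- A covering by at most `∏ (6 μ n / ε)` balls, the product being over the semi-axes of length at
least `ε / 2`. -/
lemma exists_crude_cover (hμ : ∀ n, 0 ≤ μ n) {ε : ℝ} (hε : 0 < ε) {S : Finset ℕ}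
    (hS : ∀ n, n ∈ S ↔ ε / 2 ≤ μ n) :
    ∃ T : Finset L2, (∀ x ∈ ellipsoid μ, ∃ y ∈ T, dist x y ≤ ε) ∧
      (T.card : ℝ) ≤ ∏ n ∈ S, (6 * μ n / ε) := by
  classical
  obtain ⟨T, hT, hc⟩ := exists_ellipsoid_net (η := ε / 2) (by positivity)
    (s := S) (fun n hn => (hS n).1 hn)
  refine ⟨T.image (truncate S), fun x hx => ?_, ?_⟩
  · have hsum := ((mem_ellipsoid_iff hμ).1 hx).2
    obtain ⟨c, hcT, hxc⟩ := hT x (hsum S)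
    refine ⟨_, Finset.mem_image_of_mem _ hcT, dist_truncate_le hε.le fun F => ?_⟩
    have h1 := sum_sdiff_sq_le hμ hx (S := S) (ε := ε / 2)
      (fun n hn => (not_le.1 fun h => hn ((hS n).2 h)).le) F
    have h2 := mul_le_mul_of_nonneg_left (hsum (F \ S)) (sq_nonneg (ε / 2))
    nlinarith
  · refine le_trans (by exact_mod_cast Finset.card_image_le) (hc.trans (le_of_eq ?_))
    refine Finset.prod_congr rfl fun n _ => ?_
    field_simp
    ring

/-- The crude upper bound for the entropy. -/
lemma metricEntropy_le_crude (hμ : ∀ n, 0 ≤ μ n) {ε : ℝ} (hε : 0 < ε) {S : Finset ℕ}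
    (hS : ∀ n, n ∈ S ↔ ε / 2 ≤ μ n) :
    metricEntropy ε (ellipsoid μ) ≤ ∑ n ∈ S, Real.log (6 * μ n / ε) := by
  obtain ⟨T, hT, hc⟩ := exists_crude_cover hμ hε hS
  have hpos : ∀ n ∈ S, 0 < 6 * μ n / ε := fun n hn => by
    have := (hS n).1 hn
    have : 0 < μ n := by linarith
    positivity
  have hT0 : 0 < T.card := by
    obtain ⟨y, hy, -⟩ := hT 0 (zero_mem_ellipsoid μ)
    exact Finset.card_pos.2 ⟨y, hy⟩
  refine (metricEntropy_le hε.le ⟨0, zero_mem_ellipsoid μ⟩ T hT).trans ?_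
  rw [← Real.log_prod fun n hn => (hpos n hn).ne']
  exact Real.log_le_log (by exact_mod_cast hT0) hc

/-- The volume lower bound: project to the coordinates in `S` and compare volumes. -/
lemma sum_log_le_metricEntropy (hμ : ∀ n, 0 ≤ μ n) (hlim : Tendsto μ atTop (𝓝 0)) {ε : ℝ}
    (hε : 0 < ε) {S : Finset ℕ} (hS : ∀ n ∈ S, 0 < μ n) :
    ∑ n ∈ S, Real.log (μ n / ε) ≤ metricEntropy ε (ellipsoid μ) := by
  classical
  have hpos : ∀ n ∈ S, 0 < μ n / ε := fun n hn => div_pos (hS n hn) hε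
  rw [← Real.log_prod fun n hn => (hpos n hn).ne']
  refine le_metricEntropy hε.le (Finset.prod_pos hpos) ?_ fun T hT => ?_
  · have hfin : {n | ε / 2 ≤ μ n}.Finite := by
      have h := hlim.eventually (gt_mem_nhds (show (0 : ℝ) < ε / 2 by positivity))
      rw [← Nat.cofinite_eq_atTop, eventually_cofinite] at h
      simpa using h
    obtain ⟨T, hT, -⟩ := exists_crude_cover hμ hε (S := hfin.toFinset) (by simp)
    exact ⟨T, hT⟩
  · refine (prod_le_card_of_cover hε hS (T.image fun y : L2 => (y : ℕ → ℝ)) fun x hx => ?_).trans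
      (by exact_mod_cast Finset.card_image_le)
    have hmem : truncate S x ∈ ellipsoid μ := by
      rw [mem_ellipsoid_iff hμ]
      refine ⟨fun n hn => ?_, fun F => le_trans ?_ hx⟩
      · rw [truncate_apply, if_neg fun h => (hS n h).ne' hn]
      · have : ∀ n ∈ F, (truncate S x n / μ n) ^ 2 = if n ∈ S then (x n / μ n) ^ 2 else 0 := by
          intro n _
          rw [truncate_apply]
          split_ifs <;> simp
        rw [Finset.sum_congr rfl this, ← Finset.sum_filter]
        exact Finset.sum_le_sum_of_subset_of_nonneg
          (fun n hn => (Finset.mem_filter.1 hn).2) fun _ _ _ => sq_nonneg _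
    obtain ⟨y, hy, hxy⟩ := hT _ hmem
    refine ⟨_, Finset.mem_image_of_mem _ hy, ?_⟩
    calc ∑ n ∈ S, (x n - y n) ^ 2 = ∑ n ∈ S, (truncate S x n - y n) ^ 2 :=
          Finset.sum_congr rfl fun n hn => by rw [truncate_apply, if_pos hn]
      _ ≤ _ := sum_sub_sq_le_dist_sq _ _ _
      _ ≤ ε ^ 2 := by gcongr

/-- **Block covering.** The head coordinates `S` are divided into `K` blocks, the semi-axes of
block `k` being at most `a k`. The share `w` of the defining sum that a point has in block `k` is
rounded up to a multiple `q` of `1 / (K L)`; its part in the block then lies in the ball of radius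
`a k * √q`, which is covered by a scaled copy of one fixed economical covering with balls of radius
`ε' * √q`. The squared errors add up to at most `ε' ^ 2 * (1 + 1 / L)` for every distribution of
the shares. -/
lemma metricEntropy_le_blocks (hμ : ∀ n, 0 ≤ μ n) {ε ε' m Λ : ℝ} (hε : 0 ≤ ε) (hε' : 0 < ε')
    {S : Finset ℕ} (hS : ∀ n ∉ S, μ n ≤ ε') (hS0 : ∀ n ∈ S, 0 < μ n) {K L : ℕ} (hK : 0 < K)
    (hL : 0 < L) (hεε' : ε' ^ 2 * (1 + 1 / L) ≤ ε ^ 2) (β : ℕ → Fin K) (a : Fin K → ℝ)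
    (ha : ∀ n ∈ S, μ n ≤ a (β n)) (haε : ∀ k, ε' ≤ a k) (hm : 1 ≤ m) (hSm : S.card ≤ m)
    (hΛ : ∀ k, Real.log (a k / ε') ≤ Λ) :
    metricEntropy ε (ellipsoid μ) ≤
      K * (Real.log (K * L + 1) + Real.log (245 * m ^ 3 * (1 + Λ))) +
        ∑ n ∈ S, Real.log (a (β n) / ε') := by
  classical
  have hKL : (0 : ℝ) < K * L := by positivity
  let s : Fin K → Finset ℕ := fun k => S.filter fun n => β n = k
  have hs : ∀ k, ((s k).card : ℝ) ≤ m := fun k =>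
    le_trans (by exact_mod_cast Finset.card_filter_le _ _) hSm
  choose T hT0 hT hTc using fun k =>
    exists_ball_cover_coord (s k) hε' (haε k) hm (hs k)
  let center : (Fin K → Fin (K * L + 1)) × (Fin K → ℕ → ℝ) → L2 := fun p =>
    truncate S fun n => √((p.1 (β n) : ℕ) / (K * L)) * p.2 (β n) n
  let C : Finset L2 := (Finset.univ ×ˢ Fintype.piFinset T).image center
  have hcover : ∀ x ∈ ellipsoid μ, ∃ y ∈ C, dist x y ≤ ε := by
    intro x hx
    have hsum := ((mem_ellipsoid_iff hμ).1 hx).2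
    let w : Fin K → ℝ := fun k => ∑ n ∈ s k, (x n / μ n) ^ 2
    have hw0 : ∀ k, 0 ≤ w k := fun k => Finset.sum_nonneg fun _ _ => sq_nonneg _
    have hw1 : ∀ k, w k ≤ 1 := fun k => hsum _
    let g : Fin K → Fin (K * L + 1) := fun k => ⟨⌈w k * (K * L)⌉₊, by
      rw [Nat.lt_succ_iff, Nat.ceil_le]
      push_cast
      nlinarith [hw1 k]⟩
    let q : Fin K → ℝ := fun k => ((g k : ℕ) : ℝ) / (K * L)
    have hq0 : ∀ k, 0 ≤ q k := fun k => by positivity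
    have hwq : ∀ k, w k ≤ q k := fun k => by
      rw [le_div_iff₀ hKL]
      exact Nat.le_ceil _
    have hqw : ∀ k, q k ≤ w k + 1 / (K * L) := fun k => by
      rw [div_le_iff₀ hKL, add_mul, one_div, inv_mul_cancel₀ hKL.ne']
      exact (Nat.ceil_lt_add_one (mul_nonneg (hw0 k) hKL.le)).le
    have hblock : ∀ k, ∑ n ∈ s k, x n ^ 2 ≤ a k ^ 2 * q k := by
      intro k
      calc ∑ n ∈ s k, x n ^ 2 ≤ ∑ n ∈ s k, a k ^ 2 * (x n / μ n) ^ 2 := by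
            refine Finset.sum_le_sum fun n hn => ?_
            obtain ⟨hnS, hnk⟩ := Finset.mem_filter.1 hn
            have h0 := hS0 n hnS
            have h1 := ha n hnS
            rw [hnk] at h1
            calc x n ^ 2 = μ n ^ 2 * (x n / μ n) ^ 2 := by field_simp
              _ ≤ _ := by gcongr
        _ = a k ^ 2 * w k := by rw [Finset.mul_sum]
        _ ≤ a k ^ 2 * q k := by gcongr; exact hwq k
    have hex : ∀ k, ∃ c ∈ T k, ∑ n ∈ s k, (x n - √(q k) * c n) ^ 2 ≤ ε' ^ 2 * q k := by
      intro k
      rcases (hq0 k).eq_or_lt with h0 | h0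
      · -- a block of weight zero contributes nothing
        obtain ⟨c, hc⟩ := hT0 k
        refine ⟨c, hc, ?_⟩
        have := hblock k
        rw [← h0] at this ⊢
        simpa using this
      · obtain ⟨c, hc, hxc⟩ := hT k (fun n => x n / √(q k)) (by
          simp only [div_pow, Real.sq_sqrt h0.le]
          rw [← Finset.sum_div, div_le_iff₀ h0]
          exact hblock k)
        refine ⟨c, hc, ?_⟩
        calc ∑ n ∈ s k, (x n - √(q k) * c n) ^ 2
            = ∑ n ∈ s k, q k * (x n / √(q k) - c n) ^ 2 := by
              refine Finset.sum_congr rfl fun n _ => ?_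
              have h1 : √(q k) ≠ 0 := (Real.sqrt_pos.2 h0).ne'
              have h2 : √(q k) ^ 2 = q k := Real.sq_sqrt h0.le
              generalize x n = y
              generalize √(q k) = t at h1 h2
              rw [← h2]
              field_simp
          _ = q k * ∑ n ∈ s k, (x n / √(q k) - c n) ^ 2 := by rw [Finset.mul_sum]
          _ ≤ q k * ε' ^ 2 := by gcongr
          _ = _ := mul_comm _ _
    choose c hcT hc using hex
    refine ⟨center (g, c), Finset.mem_image_of_mem _ (by
      simp only [Finset.mem_product, Finset.mem_univ, true_and, Fintype.mem_piFinset]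
      exact hcT), dist_truncate_le hε fun F => ?_⟩
    have hhead : ∑ n ∈ S, (x n - √(((g (β n) : ℕ) : ℝ) / (K * L)) * c (β n) n) ^ 2 ≤
        ε' ^ 2 * (∑ n ∈ S, (x n / μ n) ^ 2 + 1 / L) := by
      calc _ = ∑ k, ∑ n ∈ s k, (x n - √(((g (β n) : ℕ) : ℝ) / (K * L)) * c (β n) n) ^ 2 :=
            (Finset.sum_fiberwise S β _).symm
        _ = ∑ k, ∑ n ∈ s k, (x n - √(q k) * c k n) ^ 2 := by
            refine Finset.sum_congr rfl fun k _ => Finset.sum_congr rfl fun n hn => ?_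
            rw [(Finset.mem_filter.1 hn).2]
        _ ≤ ∑ k, ε' ^ 2 * (w k + 1 / (K * L)) :=
            Finset.sum_le_sum fun k _ => (hc k).trans (by gcongr; exact hqw k)
        _ = ε' ^ 2 * (∑ k, w k + 1 / L) := by
            rw [← Finset.mul_sum, Finset.sum_add_distrib, Finset.sum_const, Finset.card_univ,
              Fintype.card_fin, nsmul_eq_mul]
            congr 2
            field_simp
        _ = _ := by rw [Finset.sum_fiberwise S β fun n => (x n / μ n) ^ 2]
    have htail := sum_sdiff_sq_le hμ hx hS F
    have hall : ∑ n ∈ S, (x n / μ n) ^ 2 + ∑ n ∈ F \ S, (x n / μ n) ^ 2 ≤ 1 := by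
      rw [← Finset.sum_union Finset.disjoint_sdiff]
      exact hsum _
    refine (add_le_add hhead htail).trans (le_trans ?_ hεε')
    rw [← mul_add]
    exact mul_le_mul_of_nonneg_left (by linarith) (sq_nonneg _)
  have hlogk : ∀ k, 0 ≤ Real.log (a k / ε') := fun k =>
    Real.log_nonneg ((one_le_div hε').2 (haε k))
  have hΛ0 : 0 ≤ Λ := (hlogk ⟨0, hK⟩).trans (hΛ _)
  have hTpos : ∀ k, (0 : ℝ) < (T k).card := fun k => by exact_mod_cast (hT0 k).card_pos
  have hlogT : ∀ k, Real.log (T k).card ≤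
      Real.log (245 * m ^ 3 * (1 + Λ)) + (s k).card * Real.log (a k / ε') := by
    intro k
    have hak : 0 < a k / ε' := div_pos (hε'.trans_le (haε k)) hε'
    have h1 : (0 : ℝ) < 245 * m ^ 3 * (1 + Λ) := by positivity
    rw [← Real.log_pow, ← Real.log_mul h1.ne' (by positivity)]
    refine Real.log_le_log (hTpos k) ((hTc k).trans ?_)
    gcongr
    exact hΛ k
  have hcard : (C.card : ℝ) ≤ (K * L + 1) ^ K * ∏ k, ((T k).card : ℝ) := by
    have : C.card ≤ (K * L + 1) ^ K * ∏ k, (T k).card := by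
      refine Finset.card_image_le.trans (le_of_eq ?_)
      rw [Finset.card_product, Finset.card_univ, Fintype.card_pi, Fintype.card_piFinset]
      simp
    exact_mod_cast this
  have hC0 : 0 < C.card := by
    obtain ⟨y, hy, -⟩ := hcover 0 (zero_mem_ellipsoid μ)
    exact Finset.card_pos.2 ⟨y, hy⟩
  calc metricEntropy ε (ellipsoid μ) ≤ Real.log C.card :=
        metricEntropy_le hε ⟨0, zero_mem_ellipsoid μ⟩ C hcover
    _ ≤ Real.log ((K * L + 1) ^ K * ∏ k, ((T k).card : ℝ)) :=
        Real.log_le_log (by exact_mod_cast hC0) hcard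
    _ = K * Real.log (K * L + 1) + ∑ k, Real.log (T k).card := by
        rw [Real.log_mul (by positivity) (Finset.prod_pos fun k _ => hTpos k).ne', Real.log_pow,
          Real.log_prod fun k _ => (hTpos k).ne']
    _ ≤ K * Real.log (K * L + 1) + ∑ k : Fin K, (Real.log (245 * m ^ 3 * (1 + Λ)) +
          (s k).card * Real.log (a k / ε')) := by
        gcongr with k
        exact hlogT k
    _ = K * (Real.log (K * L + 1) + Real.log (245 * m ^ 3 * (1 + Λ))) +
        ∑ k : Fin K, ∑ n ∈ s k, Real.log (a (β n) / ε') := by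
        rw [Finset.sum_add_distrib, Finset.sum_const, Finset.card_univ, Fintype.card_fin,
          nsmul_eq_mul, mul_add (K : ℝ) (Real.log _), add_assoc]
        congr 2
        refine Finset.sum_congr rfl fun k _ => ?_
        rw [Finset.sum_congr rfl fun n hn => by rw [(Finset.mem_filter.1 hn).2], Finset.sum_const,
          nsmul_eq_mul]
    _ = _ := by rw [Finset.sum_fiberwise S β]

/-- Block covering with semi-axes grouped on a logarithmic scale: `K + 1` blocks of logarithmic
width `Θ / K`, where `Θ` bounds the logarithms of the semi-axes relative to `ε'`. Replacing each
semi-axis by the largest one of its block costs at most `Θ / K` per coordinate. -/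
lemma metricEntropy_le_log_blocks (hμ : ∀ n, 0 ≤ μ n) {ε ε' m Θ : ℝ} (hε : 0 ≤ ε) (hε' : 0 < ε')
    {S : Finset ℕ} (hS : ∀ n, n ∈ S ↔ ε' ≤ μ n) {K L : ℕ} (hK : 0 < K)
    (hL : 0 < L) (hεε' : ε' ^ 2 * (1 + 1 / L) ≤ ε ^ 2) (hm : 1 ≤ m) (hSm : S.card ≤ m)
    (hΘ : 0 < Θ) (hSΘ : ∀ n ∈ S, Real.log (μ n / ε') ≤ Θ) :
    metricEntropy ε (ellipsoid μ) ≤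
      (K + 1) * (Real.log ((K + 1) * L + 1) + Real.log (245 * m ^ 3 * (1 + 2 * Θ))) +
        ∑ n ∈ S, Real.log (μ n / ε') + m * (Θ / K) := by
  have hK1 : (1 : ℝ) ≤ K := by exact_mod_cast hK
  set δ := Θ / K with hδ_def
  have hδ : 0 < δ := by positivity
  have hKδ : K * δ = Θ := by rw [hδ_def]; field_simp
  let j : ℕ → ℕ := fun n => min ⌊Real.log (μ n / ε') / δ⌋₊ K
  let β : ℕ → Fin (K + 1) := fun n => ⟨j n, Nat.lt_succ_of_le (min_le_right _ _)⟩
  let a : Fin (K + 1) → ℝ := fun k => ε' * Real.exp (((k : ℕ) + 1) * δ)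
  have hloga : ∀ k, Real.log (a k / ε') = ((k : ℕ) + 1) * δ := fun k => by
    simp only [a]
    rw [mul_div_cancel_left₀ _ hε'.ne', Real.log_exp]
  have hS0 : ∀ n ∈ S, 0 < μ n := fun n hn => hε'.trans_le ((hS n).1 hn)
  have hnonneg : ∀ n ∈ S, 0 ≤ Real.log (μ n / ε') := fun n hn =>
    Real.log_nonneg ((one_le_div hε').2 ((hS n).1 hn))
  have hj : ∀ n ∈ S, j n = ⌊Real.log (μ n / ε') / δ⌋₊ := by
    intro n hn
    apply min_eq_left
    rw [← Nat.floor_natCast (R := ℝ) K]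
    apply Nat.floor_le_floor
    rw [div_le_iff₀ hδ, hKδ]
    exact hSΘ n hn
  have hlow : ∀ n ∈ S, j n * δ ≤ Real.log (μ n / ε') := by
    intro n hn
    rw [hj n hn, ← le_div_iff₀ hδ]
    exact Nat.floor_le (div_nonneg (hnonneg n hn) hδ.le)
  have hup : ∀ n ∈ S, Real.log (μ n / ε') ≤ (j n + 1) * δ := by
    intro n hn
    rw [hj n hn, ← div_le_iff₀ hδ]
    exact (Nat.lt_floor_add_one _).le
  have main := metricEntropy_le_blocks hμ hε hε' (S := S)
    (fun n hn => (not_le.1 fun h => hn ((hS n).2 h)).le) hS0 (Nat.succ_pos K) hL hεε' β a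
    (fun n hn => by
      have h1 := hup n hn
      rw [Real.log_le_iff_le_exp (div_pos (hS0 n hn) hε'), div_le_iff₀ hε'] at h1
      rw [mul_comm] at h1
      exact h1)
    (fun k => by
      have : 1 ≤ Real.exp (((k : ℕ) + 1) * δ) := Real.one_le_exp (by positivity)
      exact le_mul_of_one_le_right hε'.le this)
    hm hSm (Λ := 2 * Θ) (fun k => by
      rw [hloga]
      have hk : ((k : ℕ) : ℝ) ≤ K := by exact_mod_cast Nat.lt_succ_iff.1 k.2
      have : δ ≤ Θ := by rw [← hKδ]; nlinarith
      nlinarith)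
  push_cast at main
  refine main.trans ?_
  rw [add_assoc]
  gcongr
  calc ∑ n ∈ S, Real.log (a (β n) / ε') ≤ ∑ n ∈ S, (Real.log (μ n / ε') + δ) := by
        refine Finset.sum_le_sum fun n hn => ?_
        rw [hloga]
        have := hlow n hn
        simp only [β]
        linarith
    _ = ∑ n ∈ S, Real.log (μ n / ε') + S.card * δ := by
        rw [Finset.sum_add_distrib, Finset.sum_const, nsmul_eq_mul]
    _ ≤ _ := by gcongr

end EntropyBounds

/-! ### The integral of the counting function -/

section TypeIntegral

variable {μ : ℕ → ℝ}

lemma exists_finset_axes (hlim : Tendsto μ atTop (𝓝 0)) {ε : ℝ} (hε : 0 < ε) :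
    ∃ S : Finset ℕ, (∀ n, n ∈ S ↔ ε ≤ μ n) ∧ S.card = semiAxisCount μ ε := by
  have hfin : {n | ε ≤ μ n}.Finite := by
    have h := hlim.eventually (gt_mem_nhds hε)
    rw [← Nat.cofinite_eq_atTop, eventually_cofinite] at h
    simpa using h
  exact ⟨hfin.toFinset, by simp, (Set.ncard_eq_toFinset_card _ hfin).symm⟩

lemma semiAxisCount_anti (hlim : Tendsto μ atTop (𝓝 0)) {ε ε' : ℝ} (hε' : 0 < ε') (h : ε' ≤ ε) :
    semiAxisCount μ ε ≤ semiAxisCount μ ε' := by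
  obtain ⟨S, hS, hSc⟩ := exists_finset_axes hlim hε'
  obtain ⟨S', hS', hSc'⟩ := exists_finset_axes hlim (hε'.trans_le h)
  rw [← hSc, ← hSc']
  exact Finset.card_le_card fun n hn => (hS n).2 (h.trans ((hS' n).1 hn))

lemma integral_indicator_inv {ε a : ℝ} (hε : 0 < ε) (ha : ε ≤ a) :
    IntegrableOn ((Iic a).indicator fun u => u⁻¹) (Ioi ε) ∧
      ∫ u in Ioi ε, (Iic a).indicator (fun u => u⁻¹) u = Real.log (a / ε) := by
  have hint : IntegrableOn (fun u : ℝ => u⁻¹) (Ioc ε a) := by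
    rw [← intervalIntegrable_iff_integrableOn_Ioc_of_le ha]
    apply intervalIntegral.intervalIntegrable_inv (fun x hx => ?_) continuousOn_id
    rw [uIcc_of_le ha] at hx
    exact (hε.trans_le hx.1).ne'
  constructor
  · rw [integrableOn_indicator_iff measurableSet_Iic, inter_comm, Ioi_inter_Iic]
    exact hint
  · rw [setIntegral_indicator measurableSet_Iic, Ioi_inter_Iic,
      ← intervalIntegral.integral_of_le ha, integral_inv_of_pos hε (hε.trans_le ha)]

/-- Above `ε` the counting function is the sum of the step functions of the finitely many
semi-axes of length at least `ε`; integrating term by term gives `∑ ln (μ n / ε)`. -/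
lemma typeIntegral_aux (hlim : Tendsto μ atTop (𝓝 0)) {ε : ℝ} (hε : 0 < ε) {S : Finset ℕ}
    (hS : ∀ n, n ∈ S ↔ ε ≤ μ n) :
    IntegrableOn (fun u : ℝ => (semiAxisCount μ u : ℝ) / u ^ (1 : ℝ)) (Ioi ε) ∧
      typeIntegral μ 1 ε = ∑ n ∈ S, Real.log (μ n / ε) := by
  have hEq : EqOn (fun u : ℝ => ∑ n ∈ S, (Iic (μ n)).indicator (fun u => u⁻¹) u)
      (fun u : ℝ => (semiAxisCount μ u : ℝ) / u ^ (1 : ℝ)) (Ioi ε) := by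
    intro u hu
    have hu0 : 0 < u := hε.trans hu
    obtain ⟨S', hS', hc⟩ := exists_finset_axes hlim hu0
    have hSS' : S' = S.filter fun n => u ≤ μ n := by
      ext n
      rw [Finset.mem_filter, hS, hS']
      exact ⟨fun h => ⟨(le_of_lt hu).trans h, h⟩, fun h => h.2⟩
    simp only [Real.rpow_one, ← hc, hSS', Set.indicator_apply, mem_Iic]
    rw [← Finset.sum_filter, Finset.sum_const, nsmul_eq_mul, div_eq_mul_inv]
  have hterm := fun n (hn : n ∈ S) => integral_indicator_inv hε ((hS n).1 hn)
  constructor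
  · exact IntegrableOn.congr_fun (integrable_finsetSum S fun n hn => (hterm n hn).1) hEq
      measurableSet_Ioi
  · rw [typeIntegral, ← setIntegral_congr_fun measurableSet_Ioi hEq,
      integral_finsetSum S fun n hn => (hterm n hn).1]
    exact Finset.sum_congr rfl fun n hn => (hterm n hn).2

lemma hasSum_posLog (hμ : ∀ n, 0 ≤ μ n) (hlim : Tendsto μ atTop (𝓝 0)) {ε : ℝ} (hε : 0 < ε) :
    HasSum (fun n => Real.posLog (μ n / ε)) (typeIntegral μ 1 ε) := by
  obtain ⟨S, hS, -⟩ := exists_finset_axes hlim hε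
  rw [(typeIntegral_aux hlim hε hS).2]
  have h1 : ∑ n ∈ S, Real.log (μ n / ε) = ∑ n ∈ S, Real.posLog (μ n / ε) := by
    refine Finset.sum_congr rfl fun n hn => ?_
    have := (one_le_div hε).2 ((hS n).1 hn)
    rw [Real.posLog_eq_log]
    rwa [abs_of_nonneg (by linarith)]
  rw [h1]
  refine hasSum_sum_of_ne_finset_zero fun n hn => ?_
  have hlt : μ n / ε < 1 := by
    rw [div_lt_one hε]
    exact not_le.1 fun h => hn ((hS n).2 h)
  have h0 : 0 ≤ μ n / ε := div_nonneg (hμ n) hε.le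
  rw [Real.posLog_eq_zero_iff, abs_of_nonneg h0]
  exact hlt.le

lemma sum_log_le_typeIntegral (hμ : ∀ n, 0 ≤ μ n) (hlim : Tendsto μ atTop (𝓝 0)) {ε : ℝ}
    (hε : 0 < ε) (S : Finset ℕ) : ∑ n ∈ S, Real.log (μ n / ε) ≤ typeIntegral μ 1 ε :=
  (Finset.sum_le_sum fun _ _ => le_max_right _ _).trans
    (sum_le_hasSum S (fun _ _ => Real.posLog_nonneg) (hasSum_posLog hμ hlim hε))

lemma mul_semiAxisCount_le_typeIntegral (hμ : ∀ n, 0 ≤ μ n) (hlim : Tendsto μ atTop (𝓝 0)) {ε : ℝ}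
    (hε : 0 < ε) {h : ℝ} : h * semiAxisCount μ (ε * Real.exp h) ≤ typeIntegral μ 1 ε := by
  obtain ⟨S, hS, hc⟩ := exists_finset_axes hlim (mul_pos hε (Real.exp_pos h))
  refine le_trans ?_ (sum_log_le_typeIntegral hμ hlim hε S)
  rw [← hc, mul_comm, ← nsmul_eq_mul]
  refine Finset.card_nsmul_le_sum _ _ _ fun n hn => ?_
  have := (hS n).1 hn
  have hpos : 0 < μ n := (mul_pos hε (Real.exp_pos h)).trans_le this
  rw [Real.le_log_iff_exp_le (div_pos hpos hε), le_div_iff₀ hε, mul_comm]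
  exact this

/-- The lower bound `I₁(ε) ≤ H(ε)`, valid for every `ε`. -/
theorem typeIntegral_le_metricEntropy (hμ : ∀ n, 0 ≤ μ n) (hlim : Tendsto μ atTop (𝓝 0)) {ε : ℝ}
    (hε : 0 < ε) : typeIntegral μ 1 ε ≤ metricEntropy ε (ellipsoid μ) := by
  obtain ⟨S, hS, -⟩ := exists_finset_axes hlim hε
  rw [(typeIntegral_aux hlim hε hS).2]
  exact sum_log_le_metricEntropy hμ hlim hε fun n hn => hε.trans_le ((hS n).1 hn)

theorem metricEntropy_le_typeIntegral_add_count (hμ : ∀ n, 0 ≤ μ n) (hlim : Tendsto μ atTop (𝓝 0))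
    {ε : ℝ} (hε : 0 < ε) :
    metricEntropy ε (ellipsoid μ) ≤
      typeIntegral μ 1 ε + Real.log 6 * semiAxisCount μ (ε / 2) := by
  obtain ⟨S, hS, hc⟩ := exists_finset_axes hlim (half_pos hε)
  refine (metricEntropy_le_crude hμ hε hS).trans ?_
  have h1 : ∑ n ∈ S, Real.log (6 * μ n / ε) = ∑ n ∈ S, (Real.log (μ n / ε) + Real.log 6) := by
    refine Finset.sum_congr rfl fun n hn => ?_
    have hpos : 0 < μ n := (half_pos hε).trans_le ((hS n).1 hn)
    rw [mul_div_assoc, Real.log_mul (by norm_num) (div_pos hpos hε).ne', add_comm]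
  rw [h1, Finset.sum_add_distrib, Finset.sum_const, nsmul_eq_mul, hc, mul_comm]
  have := sum_log_le_typeIntegral hμ hlim hε S
  linarith

/-- The block covering bound at radius `ε`, with the semi-axes cut off at `ε e^{-1/N}` where `N`
is the number of semi-axes of length at least `ε`. -/
theorem metricEntropy_le_typeIntegral_add_blocks (hμ : ∀ n, 0 ≤ μ n)
    (hlim : Tendsto μ atTop (𝓝 0)) {ε : ℝ} (hε : 0 < ε) {N : ℕ} (hN : semiAxisCount μ ε = N)
    (hN0 : 0 < N) {m : ℝ} (hm : semiAxisCount μ (ε * Real.exp (-(1 / N))) = m) {Θ : ℝ}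
    (hΘ0 : 0 < Θ) (hΘ : ∀ n, μ n ≤ ε * Real.exp (-(1 / N)) * Real.exp Θ) {K : ℕ} (hK : 0 < K) :
    metricEntropy ε (ellipsoid μ) ≤ typeIntegral μ 1 ε + m / N +
      (K + 1) * (Real.log ((K + 1) * N + 1) + Real.log (245 * m ^ 3 * (1 + 2 * Θ))) +
        m * (Θ / K) := by
  have hN0' : (0 : ℝ) < N := by exact_mod_cast hN0
  set ε' := ε * Real.exp (-(1 / (N : ℝ))) with hε'_def
  have hε' : 0 < ε' := mul_pos hε (Real.exp_pos _)
  have hε'ε : ε' ≤ ε := mul_le_of_le_one_right hε.le (Real.exp_le_one_iff.2 (by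
    rw [neg_nonpos]; positivity))
  obtain ⟨S, hS, hc⟩ := exists_finset_axes hlim hε'
  have hcm : (S.card : ℝ) = m := by rw [hc, hm]
  have hm1 : 1 ≤ m := by
    rw [← hm]
    have := semiAxisCount_anti hlim hε' hε'ε
    exact_mod_cast (by omega : 1 ≤ semiAxisCount μ ε')
  have hS0 : ∀ n ∈ S, 0 < μ n := fun n hn => hε'.trans_le ((hS n).1 hn)
  have hrad : ε' ^ 2 * (1 + 1 / (N : ℝ)) ≤ ε ^ 2 := by
    have h1 : 1 + 1 / (N : ℝ) ≤ Real.exp (1 / N) := by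
      linarith [Real.add_one_le_exp (1 / (N : ℝ))]
    have h2 : Real.exp (-(1 / (N : ℝ))) ≤ 1 := Real.exp_le_one_iff.2 (by
      rw [neg_nonpos]; positivity)
    have h3 : Real.exp (-(1 / (N : ℝ))) * Real.exp (1 / N) = 1 := by
      rw [← Real.exp_add]; simp
    calc ε' ^ 2 * (1 + 1 / (N : ℝ)) ≤ ε' ^ 2 * Real.exp (1 / N) := by gcongr
      _ = ε ^ 2 * (Real.exp (-(1 / (N : ℝ))) *
            (Real.exp (-(1 / (N : ℝ))) * Real.exp (1 / N))) := by rw [hε'_def]; ring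
      _ ≤ ε ^ 2 * 1 := by rw [h3, mul_one]; gcongr
      _ = ε ^ 2 := mul_one _
  have main := metricEntropy_le_log_blocks hμ hε.le hε' hS hK hN0 hrad hm1 hcm.le hΘ0 (by
    intro n hn
    rw [Real.log_le_iff_le_exp (div_pos (hS0 n hn) hε'), div_le_iff₀ hε', mul_comm]
    exact hΘ n)
  have hsum : ∑ n ∈ S, Real.log (μ n / ε') ≤ typeIntegral μ 1 ε + m / N := by
    have h1 : ∑ n ∈ S, Real.log (μ n / ε') = ∑ n ∈ S, (Real.log (μ n / ε) + 1 / N) := by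
      refine Finset.sum_congr rfl fun n hn => ?_
      have h0 := hS0 n hn
      rw [hε'_def, ← div_div, Real.log_div (div_pos h0 hε).ne' (Real.exp_pos _).ne', Real.log_exp]
      ring
    rw [h1, Finset.sum_add_distrib, Finset.sum_const, nsmul_eq_mul, hcm, mul_one_div]
    have := sum_log_le_typeIntegral hμ hlim hε S
    linarith
  linarith

/-- The block covering bound with the number of blocks chosen as `√(N t / ln N)`, which balances
the cost `K ln N` of the blocks against the cost `N t / K` of rounding up the semi-axes. -/
theorem exists_metricEntropy_le_sqrt (hμ : ∀ n, 0 ≤ μ n) (hlim : Tendsto μ atTop (𝓝 0))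
    {C₀ : ℝ} (hC₀ : 1 ≤ C₀) : ∃ C : ℝ, 0 ≤ C ∧ ∀ (ε t : ℝ) (N : ℕ), 0 < ε → 1 ≤ t →
      semiAxisCount μ ε = N → 3 ≤ N → t * Real.log N ≤ N →
      semiAxisCount μ (ε * Real.exp (-(1 / (N : ℝ)))) ≤ C₀ * N →
      (∀ n, μ n ≤ ε * Real.exp (-(1 / (N : ℝ))) * Real.exp (3 * t)) →
      metricEntropy ε (ellipsoid μ) - typeIntegral μ 1 ε ≤ C * √(N * Real.log N * t) := by
  set C₁ := Real.log (1715 * C₀ ^ 3) with hC₁_def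
  have hC₁ : 0 ≤ C₁ := Real.log_nonneg (by
    have : 1 ≤ C₀ ^ 3 := one_le_pow₀ hC₀
    linarith)
  refine ⟨C₀ + 3 * (8 + C₁) + 3 * C₀, by positivity, ?_⟩
  intro ε t N hε ht hN hN3 htN hm hΘ
  have hN3' : (3 : ℝ) ≤ N := by exact_mod_cast hN3
  set l := Real.log N with hl_def
  have hl : 1 ≤ l := by
    rw [hl_def, Real.le_log_iff_exp_le (by linarith)]
    linarith [Real.exp_one_lt_d9]
  have hlN : l ≤ N := by
    have := Real.log_le_sub_one_of_pos (show (0 : ℝ) < N by linarith)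
    linarith
  set X := √(N * l * t) with hX_def
  have hX2 : X ^ 2 = N * l * t := Real.sq_sqrt (by positivity)
  have hXl : l ≤ X := by
    apply Real.le_sqrt_of_sq_le
    rw [sq]
    calc l * l ≤ N * l := by gcongr
      _ ≤ N * l * t := le_mul_of_one_le_right (by positivity) ht
  have hX0 : 0 < X := by linarith
  have hXN : X ≤ N := by
    apply Real.sqrt_le_iff.2 ⟨by linarith, ?_⟩
    nlinarith
  have htN' : t ≤ N := by nlinarith
  set K := ⌈X / l⌉₊ with hK_def
  have hK1 : X / l ≤ K := Nat.le_ceil _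
  have hK2 : (K : ℝ) ≤ X / l + 1 := (Nat.ceil_lt_add_one (by positivity)).le
  have hK0 : 0 < K := Nat.ceil_pos.2 (by positivity)
  have hXl1 : 1 ≤ X / l := (one_le_div (by linarith)).2 hXl
  have hK3 : (K : ℝ) + 1 ≤ 3 * (X / l) := by linarith
  have hK4 : (K : ℝ) + 1 ≤ 3 * N := by
    have : X / l ≤ X := div_le_self hX0.le hl
    linarith
  have hm1 : (0 : ℝ) < semiAxisCount μ (ε * Real.exp (-(1 / (N : ℝ)))) := by
    have h1 : ε * Real.exp (-(1 / (N : ℝ))) ≤ ε :=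
      mul_le_of_le_one_right hε.le (Real.exp_le_one_iff.2 (by rw [neg_nonpos]; positivity))
    have := semiAxisCount_anti hlim (mul_pos hε (Real.exp_pos _)) h1
    exact_mod_cast (by omega : 0 < semiAxisCount μ (ε * Real.exp (-(1 / (N : ℝ)))))
  have main := metricEntropy_le_typeIntegral_add_blocks hμ hlim hε hN (by omega) rfl
    (by linarith : 0 < 3 * t) hΘ hK0
  set m : ℝ := ((semiAxisCount μ (ε * Real.exp (-(1 / (N : ℝ)))) : ℕ) : ℝ) with hm_def
  have b1 : m / N ≤ C₀ * X := by
    rw [div_le_iff₀ (by linarith)]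
    nlinarith [mul_nonneg (by linarith : (0 : ℝ) ≤ C₀) (by linarith : (0 : ℝ) ≤ N)]
  have b2 : Real.log ((K + 1) * N + 1) ≤ 4 * l := by
    have e : 4 * l = Real.log ((N : ℝ) ^ 4) := by
      rw [Real.log_pow, ← hl_def]; norm_num
    rw [e]
    apply Real.log_le_log (by positivity)
    have h9 : (9 : ℝ) ≤ N ^ 2 := by nlinarith
    calc ((K : ℝ) + 1) * N + 1 ≤ 3 * N * N + 1 := by gcongr
      _ ≤ N ^ 2 * N ^ 2 := by nlinarith
      _ = N ^ 4 := by ring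
  have b3 : Real.log (245 * m ^ 3 * (1 + 2 * (3 * t))) ≤ (C₁ + 4) * l := by
    have h1 : 245 * m ^ 3 * (1 + 2 * (3 * t)) ≤ 1715 * C₀ ^ 3 * (N : ℝ) ^ 4 := by
      calc 245 * m ^ 3 * (1 + 2 * (3 * t)) ≤ 245 * (C₀ * N) ^ 3 * (7 * N) := by
            gcongr
            linarith
        _ = _ := by ring
    have h2 := Real.log_le_log (by positivity) h1
    rw [Real.log_mul (x := 1715 * C₀ ^ 3) (by positivity) (by positivity), Real.log_pow,
      ← hl_def, ← hC₁_def] at h2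
    push_cast at h2
    nlinarith
  have b4 : m * (3 * t / K) ≤ 3 * C₀ * X := by
    have h1 : t / K ≤ t * l / X := by
      rw [div_le_div_iff₀ (by exact_mod_cast hK0) hX0]
      rw [div_le_iff₀ (by linarith)] at hK1
      nlinarith
    calc m * (3 * t / K) = 3 * m * (t / K) := by ring
      _ ≤ 3 * (C₀ * N) * (t * l / X) := by gcongr
      _ = 3 * C₀ * (X ^ 2 / X) := by rw [hX2]; ring
      _ = 3 * C₀ * X := by rw [sq, mul_div_cancel_right₀ _ hX0.ne']
  have b5 : ((K : ℝ) + 1) * (Real.log ((K + 1) * N + 1) +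
      Real.log (245 * m ^ 3 * (1 + 2 * (3 * t)))) ≤ 3 * (8 + C₁) * X := by
    calc _ ≤ ((K : ℝ) + 1) * (4 * l + (C₁ + 4) * l) := by gcongr
      _ ≤ 3 * (X / l) * (4 * l + (C₁ + 4) * l) := by gcongr
      _ = _ := by field_simp; ring
  linarith

end TypeIntegral

/-! ### The regularity condition on the logarithmic scale -/

section Growth

variable {F : ℝ → ℝ}

/-- Fast growth of a function `F`, which stands for the logarithm of the counting function on the
logarithmic scale: the slope is bounded below, and bounded above on unit neighbourhoods by a small
power of `e ^ F`. -/
def FastGrowth (F : ℝ → ℝ) : Prop :=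
  (∃ c : ℝ, 0 < c ∧ ∀ᶠ t in atTop, c ≤ deriv F t) ∧
    ∀ᶠ t in atTop, ∀ s ∈ Icc (t - 1) (t + 1), deriv F s ≤ Real.exp (F t / 8)

lemma sub_le_of_deriv_le (hF : Differentiable ℝ F) {a b C : ℝ} (hab : a ≤ b)
    (h : ∀ s ∈ Icc a b, deriv F s ≤ C) : F b - F a ≤ C * (b - a) :=
  (convex_Icc a b).image_sub_le_mul_sub_of_deriv_le hF.continuous.continuousOn
    hF.differentiableOn (fun x hx => h x (interior_subset hx)) a (left_mem_Icc.2 hab) b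
    (right_mem_Icc.2 hab) hab

lemma le_sub_of_le_deriv (hF : Differentiable ℝ F) {a b C : ℝ} (hab : a ≤ b)
    (h : ∀ s ∈ Icc a b, C ≤ deriv F s) : C * (b - a) ≤ F b - F a :=
  (convex_Icc a b).mul_sub_le_image_sub_of_le_deriv hF.continuous.continuousOn
    hF.differentiableOn (fun x hx => h x (interior_subset hx)) a (left_mem_Icc.2 hab) b
    (right_mem_Icc.2 hab) hab

lemma eventually_linear_le (hF : Differentiable ℝ F) {c : ℝ} (hc : 0 < c)
    (h : ∀ᶠ t in atTop, c ≤ deriv F t) : ∀ᶠ t in atTop, c / 2 * t ≤ F t := by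
  obtain ⟨t₁, ht₁⟩ := eventually_atTop.1 h
  filter_upwards [eventually_ge_atTop t₁,
    (tendsto_id.const_mul_atTop (half_pos hc)).eventually_ge_atTop (c * t₁ - F t₁)] with t h1 h2
  have := le_sub_of_le_deriv hF h1 fun s hs => ht₁ s hs.1
  simp only [id] at h2
  linarith

lemma tendsto_atTop_of_le_deriv (hF : Differentiable ℝ F) {c : ℝ} (hc : 0 < c)
    (h : ∀ᶠ t in atTop, c ≤ deriv F t) : Tendsto F atTop atTop :=
  tendsto_atTop_mono' _ (eventually_linear_le hF hc h)
    (tendsto_id.const_mul_atTop (half_pos hc))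

lemma fastGrowth_of_tendsto (hF : Differentiable ℝ F) {b : ℝ} (hb : 0 < b)
    (h : Tendsto (deriv F) atTop (𝓝 b)) : FastGrowth F := by
  have h1 : ∀ᶠ t in atTop, b / 2 ≤ deriv F t :=
    (h.eventually (lt_mem_nhds (half_lt_self hb))).mono fun _ => le_of_lt
  have h2 : ∀ᶠ t in atTop, deriv F t ≤ 2 * b :=
    (h.eventually (gt_mem_nhds (by linarith : b < 2 * b))).mono fun _ => le_of_lt
  refine ⟨⟨b / 2, half_pos hb, h1⟩, ?_⟩
  have h3 := (tendsto_atTop_add_const_right atTop (-1 : ℝ) tendsto_id).eventually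
    (eventually_forall_ge_atTop.2 h2)
  filter_upwards [h3, (tendsto_atTop_of_le_deriv hF (half_pos hb) h1).eventually_ge_atTop (16 * b)]
    with t h4 h5 s hs
  have := h4 s (by simpa [sub_eq_add_neg] using hs.1)
  have := Real.add_one_le_exp (F t / 8)
  linarith

/-- The condition `ln ρ(t) = O(ρ(t/2))` on the slope `ρ` of `F` bounds `ρ` by a power of `e ^ F`,
since `F t` exceeds every multiple of `ρ(t/2)`. -/
lemma fastGrowth_of_monotone (hF : Differentiable ℝ F) (hmono : Monotone F)
    (h : Tendsto (deriv F) atTop atTop)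
    (hO : (fun t => Real.log (deriv F t)) =O[atTop] fun t => deriv F (t / 2))
    {t₀ : ℝ} (ht₀ : MonotoneOn (deriv F) (Ioi t₀)) : FastGrowth F := by
  refine ⟨⟨1, one_pos, h.eventually_ge_atTop 1⟩, ?_⟩
  obtain ⟨C, hC, hO⟩ := hO.exists_pos
  have hshift : Tendsto (fun t : ℝ => t + 1) atTop atTop :=
    tendsto_atTop_add_const_right atTop (1 : ℝ) tendsto_id
  have hhalf : Tendsto (fun t : ℝ => (t + 1) / 2) atTop atTop := hshift.atTop_div_const two_pos
  filter_upwards [hshift.eventually hO.bound, hhalf.eventually (h.eventually_ge_atTop 1),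
    hshift.eventually (h.eventually_ge_atTop 1), hhalf.eventually_gt_atTop t₀,
    eventually_gt_atTop (t₀ + 1), eventually_ge_atTop (16 * C + 2 * |F 0| + 1)]
    with t h1 h2 h3 h4 h5 h6 s hs
  have hF0 := abs_nonneg (F 0)
  have ht1 : 1 ≤ t := by linarith
  set r := deriv F ((t + 1) / 2) with hr
  have hFt : r * (t - (t + 1) / 2) ≤ F t - F ((t + 1) / 2) :=
    le_sub_of_le_deriv hF (by linarith) fun s hs => ht₀ h4 (h4.trans_le hs.1) hs.1
  have hF0' : F 0 ≤ F ((t + 1) / 2) := hmono (by linarith)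
  have hlog : Real.log (deriv F (t + 1)) ≤ C * r := by
    refine (le_abs_self _).trans ?_
    rwa [Real.norm_eq_abs, Real.norm_eq_abs, abs_of_nonneg (by linarith : 0 ≤ r)] at h1
  have hCr : C * r ≤ F t / 8 := by
    have := neg_abs_le (F 0)
    nlinarith
  calc deriv F s ≤ deriv F (t + 1) :=
        ht₀ (by simp only [mem_Ioi]; linarith [hs.1]) (by simp only [mem_Ioi]; linarith) hs.2
    _ = Real.exp (Real.log (deriv F (t + 1))) := (Real.exp_log (by linarith)).symm
    _ ≤ _ := Real.exp_le_exp.2 (hlog.trans hCr)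

lemma tendsto_exp_neg_nhdsGT : Tendsto (fun t : ℝ => Real.exp (-t)) atTop (𝓝[>] 0) :=
  tendsto_nhdsWithin_iff.2 ⟨Real.tendsto_exp_neg_atTop_nhds_zero,
    Eventually.of_forall fun _ => Real.exp_pos _⟩

/-- The regularity condition on the logarithmic scale: up to a factor of two the counting function
is `e ^ F`, where the slope of the non-decreasing function `F` tends to zero or `F` grows fast. -/
theorem RegularityCondition.exists_log {M : ℝ → ℝ} (hM : RegularityCondition M) :
    ∃ F : ℝ → ℝ, Differentiable ℝ F ∧ Monotone F ∧
      (∀ᶠ t in atTop, Real.exp (F t) ≤ 2 * M (Real.exp (-t)) ∧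
        M (Real.exp (-t)) ≤ 2 * Real.exp (F t)) ∧
      (Tendsto (deriv F) atTop (𝓝 0) ∨ FastGrowth F) := by
  obtain ⟨f, hf, hpos, hanti, hMf, hρ⟩ := hM
  let F : ℝ → ℝ := fun t => Real.log (f (Real.exp (-t)))
  have hFdiff : Differentiable ℝ F := by
    intro t
    have h1 : DifferentiableAt ℝ f (Real.exp (-t)) :=
      (hf.differentiableOn one_ne_zero).differentiableAt (Ioi_mem_nhds (Real.exp_pos _))
    have h2 : DifferentiableAt ℝ (fun t : ℝ => Real.exp (-t)) t := by fun_prop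
    exact (DifferentiableAt.comp t h1 h2).log (hpos _ (Real.exp_pos _)).ne'
  have hFmono : Monotone F := by
    intro t t' htt
    exact Real.log_le_log (hpos _ (Real.exp_pos _))
      (hanti (Real.exp_pos _) (Real.exp_pos _) (Real.exp_le_exp.2 (neg_le_neg htt)))
  have hexp : ∀ t, Real.exp (F t) = f (Real.exp (-t)) := fun t =>
    Real.exp_log (hpos _ (Real.exp_pos _))
  refine ⟨F, hFdiff, hFmono, ?_, ?_⟩
  · have h1 := tendsto_exp_neg_nhdsGT.eventually
      (hMf.isLittleO.bound (show (0 : ℝ) < 1 / 2 by norm_num))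
    filter_upwards [h1] with t ht
    have h0 := hpos _ (Real.exp_pos (-t))
    rw [hexp]
    rw [Pi.sub_apply, Real.norm_eq_abs, Real.norm_eq_abs, abs_of_pos h0, abs_le] at ht
    constructor <;> linarith [ht.1, ht.2]
  · rcases hρ with ⟨b, hb⟩ | ⟨h1, h2, t₀, -, h3⟩
    · have hb0 : 0 ≤ b := ge_of_tendsto' hb fun t => hFmono.deriv_nonneg
      rcases hb0.eq_or_lt with rfl | hb0
      · exact Or.inl hb
      · exact Or.inr (fastGrowth_of_tendsto hFdiff hb0 hb)
    · exact Or.inr (fastGrowth_of_monotone hFdiff hFmono h1 h2 h3)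

lemma eventually_deriv_le_exp (hmono : Monotone F) (hF : Differentiable ℝ F)
    (h : Tendsto (deriv F) atTop (𝓝 0) ∨ FastGrowth F) :
    ∀ᶠ t in atTop, ∀ s ∈ Icc t (t + 1), deriv F s ≤ Real.exp (F t) := by
  rcases h with h | ⟨⟨c, hc, h1⟩, h2⟩
  · have h1 : ∀ᶠ t in atTop, deriv F t ≤ Real.exp (F 0) :=
      (h.eventually (gt_mem_nhds (Real.exp_pos (F 0)))).mono fun _ => le_of_lt
    filter_upwards [eventually_forall_ge_atTop.2 h1, eventually_ge_atTop 0] with t h1 h0 s hs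
    exact (h1 s hs.1).trans (Real.exp_le_exp.2 (hmono h0))
  · filter_upwards [h2, (tendsto_atTop_of_le_deriv hF hc h1).eventually_ge_atTop 0] with t h2 h0 s hs
    exact (h2 s ⟨by linarith [hs.1], hs.2⟩).trans (Real.exp_le_exp.2 (by linarith))

end Growth

/-! ### Asymptotics -/

section Asymptotics

variable {μ : ℕ → ℝ} {F : ℝ → ℝ}

/-- On the logarithmic scale the counting function agrees with `e ^ F` up to a factor of two. -/
def LogCountComparable (μ : ℕ → ℝ) (F : ℝ → ℝ) : Prop :=
  ∀ᶠ t in atTop, Real.exp (F t) ≤ 2 * (semiAxisCount μ (Real.exp (-t)) : ℝ) ∧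
    (semiAxisCount μ (Real.exp (-t)) : ℝ) ≤ 2 * Real.exp (F t)

lemma exp_neg_mul_exp (t a : ℝ) : Real.exp (-t) * Real.exp (-a) = Real.exp (-(t + a)) := by
  rw [← Real.exp_add]; ring_nf

lemma semiAxisCount_shift_le {C a t : ℝ} (hsub : F (t + a) - F t ≤ C)
    (h : Real.exp (F t) ≤ 2 * (semiAxisCount μ (Real.exp (-t)) : ℝ))
    (h' : (semiAxisCount μ (Real.exp (-(t + a))) : ℝ) ≤ 2 * Real.exp (F (t + a))) :
    (semiAxisCount μ (Real.exp (-(t + a))) : ℝ) ≤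
      4 * Real.exp C * semiAxisCount μ (Real.exp (-t)) := by
  calc _ ≤ 2 * Real.exp (F (t + a)) := h'
    _ ≤ 2 * (Real.exp C * Real.exp (F t)) := by
        rw [← Real.exp_add]
        gcongr
        linarith
    _ ≤ 2 * (Real.exp C * (2 * (semiAxisCount μ (Real.exp (-t)) : ℝ))) := by gcongr
    _ = _ := by ring

/-- The bound `O(√(M ln M ln (1/ε)))` in the range `ln (1/ε) ln M ≤ M`. -/
lemma exists_eventually_le_sqrt (hμ : ∀ n, 0 ≤ μ n) (hlim : Tendsto μ atTop (𝓝 0))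
    (hF : Differentiable ℝ F) (hcmp : LogCountComparable μ F)
    (hslope : ∀ᶠ t in atTop, ∀ s ∈ Icc t (t + 1), deriv F s ≤ Real.exp (F t)) :
    ∃ C : ℝ, 0 ≤ C ∧ ∀ᶠ t in atTop, 3 ≤ semiAxisCount μ (Real.exp (-t)) →
      t * Real.log (semiAxisCount μ (Real.exp (-t))) ≤ semiAxisCount μ (Real.exp (-t)) →
      metricEntropy (Real.exp (-t)) (ellipsoid μ) - typeIntegral μ 1 (Real.exp (-t)) ≤
        C * √((semiAxisCount μ (Real.exp (-t)) : ℝ) *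
          Real.log (semiAxisCount μ (Real.exp (-t))) * t) := by
  obtain ⟨C, hC, hmain⟩ := exists_metricEntropy_le_sqrt hμ hlim (C₀ := 4 * Real.exp 2)
    (by linarith [Real.add_one_le_exp (2 : ℝ)])
  refine ⟨C, hC, ?_⟩
  obtain ⟨B, hB⟩ := hlim.bddAbove_range
  filter_upwards [eventually_forall_ge_atTop.2 hcmp, hslope, eventually_ge_atTop (|B| + 1)]
    with t h1 h2 h3 hN htN
  set N := semiAxisCount μ (Real.exp (-t)) with hN_def
  have hN' : (3 : ℝ) ≤ N := by exact_mod_cast hN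
  have hN0 : 0 < 1 / (N : ℝ) := by positivity
  have hN1 : 1 / (N : ℝ) ≤ 1 := by
    rw [div_le_one (by linarith)]; linarith
  have habs := abs_nonneg B
  refine hmain (Real.exp (-t)) t N (Real.exp_pos _) (by linarith) hN_def.symm hN htN ?_ ?_
  · rw [exp_neg_mul_exp]
    refine semiAxisCount_shift_le ?_ (h1 t le_rfl).1 (h1 _ (by linarith)).2
    have h4 := sub_le_of_deriv_le hF (by linarith : t ≤ t + 1 / N) fun s hs =>
      h2 s ⟨hs.1, by linarith [hs.2]⟩
    refine h4.trans ?_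
    rw [add_sub_cancel_left, mul_one_div, div_le_iff₀ (by linarith)]
    exact (h1 t le_rfl).1
  · intro n
    rw [exp_neg_mul_exp, ← Real.exp_add]
    have h5 : μ n ≤ B := hB ⟨n, rfl⟩
    have h6 := Real.add_one_le_exp (-(t + 1 / (N : ℝ)) + 3 * t)
    linarith [le_abs_self B]

/-- If the slope of `F` tends to zero, halving the radius changes the counting function by at most
a constant factor, and the crude covering gives the bound `O(M)`. -/
lemma exists_eventually_le_count (hμ : ∀ n, 0 ≤ μ n) (hlim : Tendsto μ atTop (𝓝 0))
    (hF : Differentiable ℝ F) (hcmp : LogCountComparable μ F)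
    (hslope : Tendsto (deriv F) atTop (𝓝 0)) :
    ∃ C : ℝ, 0 ≤ C ∧ ∀ᶠ t in atTop,
      metricEntropy (Real.exp (-t)) (ellipsoid μ) - typeIntegral μ 1 (Real.exp (-t)) ≤
        C * semiAxisCount μ (Real.exp (-t)) := by
  have hlog6 : 0 ≤ Real.log 6 := Real.log_nonneg (by norm_num)
  refine ⟨Real.log 6 * (4 * Real.exp 1), by positivity, ?_⟩
  have h1 : ∀ᶠ t in atTop, deriv F t ≤ 1 :=
    (hslope.eventually (gt_mem_nhds one_pos)).mono fun _ => le_of_lt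
  filter_upwards [eventually_forall_ge_atTop.2 hcmp, eventually_forall_ge_atTop.2 h1] with t h1 h2
  have hl2 : 0 < Real.log 2 := Real.log_pos one_lt_two
  have hl2' : Real.log 2 ≤ 1 := by linarith [Real.log_two_lt_d9]
  have h3 := metricEntropy_le_typeIntegral_add_count hμ hlim (Real.exp_pos (-t))
  have h4 : Real.exp (-t) / 2 = Real.exp (-(t + Real.log 2)) := by
    rw [← exp_neg_mul_exp, Real.exp_neg (Real.log 2), Real.exp_log two_pos, div_eq_mul_inv]
  rw [h4] at h3
  have h5 : F (t + Real.log 2) - F t ≤ 1 := by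
    have := sub_le_of_deriv_le hF (by linarith : t ≤ t + Real.log 2) fun s hs => h2 s hs.1
    linarith
  have h6 := semiAxisCount_shift_le h5 (h1 t le_rfl).1 (h1 _ (by linarith)).2
  have h7 := mul_le_mul_of_nonneg_left h6 hlog6
  linarith

/-- If `F` grows by at most one between `t - h` and `t`, the semi-axes counted at `t - h` alone
make the integral at least a multiple of `h e ^ F`. -/
lemma mul_exp_le_typeIntegral (hμ : ∀ n, 0 ≤ μ n) (hlim : Tendsto μ atTop (𝓝 0)) {t h : ℝ}
    (hh : 0 ≤ h) (hsub : F t - F (t - h) ≤ 1)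
    (hcmp : Real.exp (F (t - h)) ≤ 2 * (semiAxisCount μ (Real.exp (-(t - h))) : ℝ)) :
    h * Real.exp (F t) ≤ 2 * Real.exp 1 * typeIntegral μ 1 (Real.exp (-t)) := by
  have h1 := mul_semiAxisCount_le_typeIntegral hμ hlim (Real.exp_pos (-t)) (h := h)
  rw [← Real.exp_add, show -t + h = -(t - h) by ring] at h1
  calc h * Real.exp (F t) ≤ h * (Real.exp 1 * Real.exp (F (t - h))) := by
        rw [← Real.exp_add]
        gcongr
        linarith
    _ ≤ h * (Real.exp 1 * (2 * (semiAxisCount μ (Real.exp (-(t - h))) : ℝ))) := by gcongr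
    _ = 2 * Real.exp 1 * (h * (semiAxisCount μ (Real.exp (-(t - h))) : ℝ)) := by ring
    _ ≤ _ := by gcongr

lemma isLittleO_count_typeIntegral (hμ : ∀ n, 0 ≤ μ n) (hlim : Tendsto μ atTop (𝓝 0))
    (hF : Differentiable ℝ F) (hcmp : LogCountComparable μ F)
    (hslope : Tendsto (deriv F) atTop (𝓝 0)) :
    (fun t => (semiAxisCount μ (Real.exp (-t)) : ℝ)) =o[atTop]
      fun t => typeIntegral μ 1 (Real.exp (-t)) := by
  rw [isLittleO_iff]
  intro c hc
  set A := 4 * Real.exp 1 / c with hA_def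
  have hA : 0 < A := by positivity
  have h1 : ∀ᶠ t in atTop, deriv F t ≤ 1 / A :=
    (hslope.eventually (gt_mem_nhds (by positivity))).mono fun _ => le_of_lt
  have hshift : Tendsto (fun t : ℝ => t - A) atTop atTop :=
    tendsto_atTop_add_const_right atTop (-A) tendsto_id
  filter_upwards [hcmp, hshift.eventually hcmp,
    hshift.eventually (eventually_forall_ge_atTop.2 h1)] with t h2 h3 h4
  have h5 : F t - F (t - A) ≤ 1 := by
    have := sub_le_of_deriv_le hF (by linarith : t - A ≤ t) fun s hs => h4 s hs.1
    rwa [sub_sub_cancel, one_div, inv_mul_cancel₀ hA.ne'] at this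
  have h6 := mul_exp_le_typeIntegral hμ hlim hA.le h5 h3.1
  have h7 : A * c = 4 * Real.exp 1 := by rw [hA_def]; field_simp
  rw [Real.norm_eq_abs, Real.norm_eq_abs, abs_of_nonneg (Nat.cast_nonneg _)]
  refine le_trans ?_ (mul_le_mul_of_nonneg_left (le_abs_self _) hc.le)
  have h8 : 0 < 4 * Real.exp 1 := by positivity
  refine le_of_mul_le_mul_left ?_ h8
  calc 4 * Real.exp 1 * (semiAxisCount μ (Real.exp (-t)) : ℝ)
      = A * c * (semiAxisCount μ (Real.exp (-t)) : ℝ) := by rw [h7]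
    _ ≤ A * c * (2 * Real.exp (F t)) := by gcongr; exact h2.2
    _ = 2 * c * (A * Real.exp (F t)) := by ring
    _ ≤ 2 * c * (2 * Real.exp 1 * typeIntegral μ 1 (Real.exp (-t))) := by gcongr
    _ = _ := by ring

/-- Under fast growth, `t` and `ln M` are both `O(F)`, hence `t ln M = O(F ^ 2)`. -/
lemma FastGrowth.exists_mul_log_le (hF : Differentiable ℝ F) (hfast : FastGrowth F)
    (hcmp : LogCountComparable μ F) :
    ∃ C : ℝ, 0 < C ∧ ∀ᶠ t in atTop,
      Real.log (semiAxisCount μ (Real.exp (-t))) * t ≤ C * F t ^ 2 := by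
  obtain ⟨⟨c, hc, h1⟩, -⟩ := hfast
  refine ⟨4 / c, by positivity, ?_⟩
  filter_upwards [hcmp, eventually_linear_le hF hc h1,
    (tendsto_atTop_of_le_deriv hF hc h1).eventually_ge_atTop 1, eventually_ge_atTop 0]
    with t h2 h3 h4 h5
  have hM : (0 : ℝ) < semiAxisCount μ (Real.exp (-t)) := by
    have := Real.exp_pos (F t)
    linarith [h2.1]
  have h6 : Real.log (semiAxisCount μ (Real.exp (-t))) ≤ 2 * F t := by
    have := Real.log_le_log hM h2.2
    rw [Real.log_mul two_ne_zero (Real.exp_pos _).ne', Real.log_exp] at this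
    linarith [Real.log_two_lt_d9]
  have h7 : t ≤ 2 / c * F t := by
    rw [div_mul_eq_mul_div, le_div_iff₀ hc]
    linarith
  calc Real.log (semiAxisCount μ (Real.exp (-t))) * t ≤ 2 * F t * (2 / c * F t) := by gcongr
    _ = _ := by ring

lemma FastGrowth.eventually_mul_log_le (hF : Differentiable ℝ F) (hfast : FastGrowth F)
    (hcmp : LogCountComparable μ F) :
    ∀ᶠ t in atTop, 3 ≤ semiAxisCount μ (Real.exp (-t)) ∧
      t * Real.log (semiAxisCount μ (Real.exp (-t))) ≤ semiAxisCount μ (Real.exp (-t)) := by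
  obtain ⟨C, hC, h1⟩ := hfast.exists_mul_log_le hF hcmp
  obtain ⟨⟨c, hc, h2⟩, -⟩ := hfast
  have hFtop := tendsto_atTop_of_le_deriv hF hc h2
  have h3 := ((Real.tendsto_pow_mul_exp_neg_atTop_nhds_zero 2).comp hFtop).eventually
    (gt_mem_nhds (show (0 : ℝ) < 1 / (2 * C) by positivity))
  filter_upwards [hcmp, h1, h3, hFtop.eventually_ge_atTop 5] with t h4 h5 h6 h7
  constructor
  · have := Real.add_one_le_exp (F t)
    have : (3 : ℝ) ≤ semiAxisCount μ (Real.exp (-t)) := by linarith [h4.1]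
    exact_mod_cast this
  · simp only [Function.comp_apply] at h6
    rw [Real.exp_neg, ← div_eq_mul_inv, div_lt_div_iff₀ (Real.exp_pos _) (by positivity)] at h6
    linarith [h4.1]

lemma FastGrowth.isLittleO_sqrt_typeIntegral (hμ : ∀ n, 0 ≤ μ n) (hlim : Tendsto μ atTop (𝓝 0))
    (hF : Differentiable ℝ F) (hfast : FastGrowth F) (hcmp : LogCountComparable μ F) :
    (fun t => √((semiAxisCount μ (Real.exp (-t)) : ℝ) *
      Real.log (semiAxisCount μ (Real.exp (-t))) * t)) =o[atTop]
      fun t => typeIntegral μ 1 (Real.exp (-t)) := by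
  obtain ⟨C, hC, h1⟩ := hfast.exists_mul_log_le hF hcmp
  obtain ⟨⟨c, hc, h2⟩, hup⟩ := hfast
  have hFtop := tendsto_atTop_of_le_deriv hF hc h2
  rw [isLittleO_iff]
  intro δ hδ
  have hcst : 0 < δ / (8 * Real.exp 1 * √(2 * C)) := by positivity
  have h3 := ((Real.tendsto_pow_mul_exp_neg_atTop_nhds_zero 1).comp
    (hFtop.const_mul_atTop (show (0 : ℝ) < 3 / 8 by norm_num))).eventually (gt_mem_nhds hcst)
  have hshift : Tendsto (fun t : ℝ => t - 1) atTop atTop :=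
    tendsto_atTop_add_const_right atTop (-1) tendsto_id
  filter_upwards [hcmp, hshift.eventually (eventually_forall_ge_atTop.2 hcmp), h1, h3, hup,
    hFtop.eventually_ge_atTop 0] with t h4 h5 h6 h7 h8 h9
  -- the slope is at most `1 / h` on `[t - h, t]`
  set h := Real.exp (-(F t / 8)) with hh_def
  have hh0 : 0 < h := Real.exp_pos _
  have hh1 : h ≤ 1 := Real.exp_le_one_iff.2 (by linarith)
  have h10 : F t - F (t - h) ≤ 1 := by
    have := sub_le_of_deriv_le hF (by linarith : t - h ≤ t) fun s hs =>
      h8 s ⟨by linarith [hs.1], by linarith [hs.2]⟩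
    rwa [sub_sub_cancel, hh_def, ← Real.exp_add, add_neg_cancel, Real.exp_zero] at this
  have h11 := mul_exp_le_typeIntegral hμ hlim hh0.le h10 (h5 _ (by linarith)).1
  have h12 : h * Real.exp (F t) = Real.exp (F t / 2) * Real.exp (3 / 8 * F t) := by
    rw [hh_def, ← Real.exp_add, ← Real.exp_add]; ring_nf
  rw [h12] at h11
  have h13 : √((semiAxisCount μ (Real.exp (-t)) : ℝ) *
      Real.log (semiAxisCount μ (Real.exp (-t))) * t) ≤ √(2 * C) * F t * Real.exp (F t / 2) := by
    rw [Real.sqrt_le_left (by positivity), mul_assoc]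
    calc _ ≤ (semiAxisCount μ (Real.exp (-t)) : ℝ) * (C * F t ^ 2) := by gcongr
      _ ≤ 2 * Real.exp (F t) * (C * F t ^ 2) := by gcongr; exact h4.2
      _ = _ := by
          rw [mul_pow, mul_pow, Real.sq_sqrt (by positivity), ← Real.exp_nat_mul,
            show ((2 : ℕ) : ℝ) * (F t / 2) = F t by push_cast; ring]
          ring
  rw [Real.norm_eq_abs, Real.norm_eq_abs, abs_of_nonneg (Real.sqrt_nonneg _)]
  refine le_trans ?_ (mul_le_mul_of_nonneg_left (le_abs_self _) hδ.le)
  refine h13.trans ?_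
  simp only [Function.comp_apply, pow_one] at h7
  rw [Real.exp_neg, ← div_eq_mul_inv, div_lt_div_iff₀ (Real.exp_pos _) (by positivity)] at h7
  have h14 : √(2 * C) * F t * (2 * Real.exp 1) ≤ δ * Real.exp (3 / 8 * F t) := by
    refine le_trans ?_ h7.le
    have : 0 ≤ √(2 * C) * F t * Real.exp 1 := by positivity
    nlinarith
  have h15 : 0 < 2 * Real.exp 1 := by positivity
  refine le_of_mul_le_mul_left ?_ h15
  calc 2 * Real.exp 1 * (√(2 * C) * F t * Real.exp (F t / 2))
      = √(2 * C) * F t * (2 * Real.exp 1) * Real.exp (F t / 2) := by ring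
    _ ≤ δ * Real.exp (3 / 8 * F t) * Real.exp (F t / 2) := by gcongr
    _ = δ * (Real.exp (F t / 2) * Real.exp (3 / 8 * F t)) := by ring
    _ ≤ δ * (2 * Real.exp 1 * typeIntegral μ 1 (Real.exp (-t))) := by gcongr
    _ = _ := by ring

/-- Transfer from the logarithmic scale: limits `t → ∞` become limits `ε → 0+` with
`t = ln (1/ε)`. -/
lemma eventually_nhdsGT_of_atTop {P : ℝ → ℝ → Prop} (h : ∀ᶠ t in atTop, P (Real.exp (-t)) t) :
    ∀ᶠ ε in 𝓝[>] (0 : ℝ), P ε (Real.log ε⁻¹) := by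
  have := (Real.tendsto_log_atTop.comp tendsto_inv_nhdsGT_zero).eventually h
  filter_upwards [this, self_mem_nhdsWithin] with ε hε hpos
  simpa [Real.log_inv, Real.exp_log hpos] using hε

/-- The remainder estimate on the logarithmic scale. -/
lemma exists_eventually_le_min (hμ : ∀ n, 0 ≤ μ n) (hlim : Tendsto μ atTop (𝓝 0))
    (hF : Differentiable ℝ F) (hmono : Monotone F) (hcmp : LogCountComparable μ F)
    (hslope : Tendsto (deriv F) atTop (𝓝 0) ∨ FastGrowth F)
    (htwo : ∃ m n : ℕ, m ≠ n ∧ 0 < μ m ∧ 0 < μ n) :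
    ∃ C : ℝ, ∀ᶠ t in atTop,
      metricEntropy (Real.exp (-t)) (ellipsoid μ) - typeIntegral μ 1 (Real.exp (-t)) ≤
        C * min (semiAxisCount μ (Real.exp (-t)) : ℝ)
          (√((semiAxisCount μ (Real.exp (-t)) : ℝ) *
            Real.log (semiAxisCount μ (Real.exp (-t))) * t)) := by
  obtain ⟨C₂, hC₂, h2⟩ := exists_eventually_le_sqrt hμ hlim hF hcmp
    (eventually_deriv_le_exp hmono hF hslope)
  have hsqrt : ∀ {t N : ℝ}, 0 ≤ N → t * Real.log N ≤ N → √(N * Real.log N * t) ≤ N := by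
    intro t N hN h
    rw [Real.sqrt_le_left hN, mul_assoc, mul_comm (Real.log N), sq]
    gcongr
  rcases hslope with hslope | hfast
  · obtain ⟨C₁, hC₁, h1⟩ := exists_eventually_le_count hμ hlim hF hcmp hslope
    refine ⟨C₁ + C₂, ?_⟩
    have htwo' : ∀ᶠ t in atTop, 2 ≤ semiAxisCount μ (Real.exp (-t)) := by
      obtain ⟨m, n, hmn, hm, hn⟩ := htwo
      filter_upwards [Real.tendsto_exp_neg_atTop_nhds_zero.eventually (gt_mem_nhds hm),
        Real.tendsto_exp_neg_atTop_nhds_zero.eventually (gt_mem_nhds hn)] with t h1 h2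
      obtain ⟨S, hS, hc⟩ := exists_finset_axes hlim (Real.exp_pos (-t))
      rw [← hc, ← Finset.card_pair hmn]
      refine Finset.card_le_card fun k hk => ?_
      rw [hS]
      rcases Finset.mem_insert.1 hk with rfl | hk
      · exact h1.le
      · rw [Finset.mem_singleton.1 hk]; exact h2.le
    filter_upwards [h1, h2, htwo', eventually_ge_atTop 3] with t h1 h2 h3 h4
    set N := semiAxisCount μ (Real.exp (-t)) with hN
    have hN2 : (2 : ℝ) ≤ N := by exact_mod_cast h3
    rcases le_or_gt (t * Real.log N) N with h5 | h5
    · have hN3 : 3 ≤ N := by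
        by_contra hlt
        have hN2' : N = 2 := by omega
        rw [hN2'] at h5
        push_cast at h5
        nlinarith [Real.log_two_gt_d9]
      have h6 := h2 hN3 h5
      rw [min_eq_right (hsqrt (by linarith) h5)]
      have := mul_nonneg hC₁ (Real.sqrt_nonneg (N * Real.log N * t))
      linarith
    · have h6 : (N : ℝ) ≤ √(N * Real.log N * t) := by
        apply Real.le_sqrt_of_sq_le
        rw [mul_assoc, mul_comm (Real.log _), sq]
        gcongr
      rw [min_eq_left h6]
      have := mul_nonneg hC₂ (by linarith : (0 : ℝ) ≤ N)
      linarith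
  · refine ⟨C₂, ?_⟩
    filter_upwards [h2, hfast.eventually_mul_log_le hF hcmp] with t h2 h3
    rw [min_eq_right (hsqrt (Nat.cast_nonneg _) h3.2)]
    exact h2 h3.1 h3.2

/-- The remainder is of smaller order than the integral. -/
lemma isLittleO_remainder (hμ : ∀ n, 0 ≤ μ n) (hlim : Tendsto μ atTop (𝓝 0))
    (hF : Differentiable ℝ F) (hmono : Monotone F) (hcmp : LogCountComparable μ F)
    (hslope : Tendsto (deriv F) atTop (𝓝 0) ∨ FastGrowth F) :
    (fun t => metricEntropy (Real.exp (-t)) (ellipsoid μ) - typeIntegral μ 1 (Real.exp (-t)))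
      =o[atTop] fun t => typeIntegral μ 1 (Real.exp (-t)) := by
  have hnonneg : ∀ t, 0 ≤ metricEntropy (Real.exp (-t)) (ellipsoid μ) -
      typeIntegral μ 1 (Real.exp (-t)) := fun t =>
    sub_nonneg.2 (typeIntegral_le_metricEntropy hμ hlim (Real.exp_pos _))
  obtain ⟨C₂, hC₂, h2⟩ := exists_eventually_le_sqrt hμ hlim hF hcmp
    (eventually_deriv_le_exp hmono hF hslope)
  rcases hslope with hslope | hfast
  · obtain ⟨C₁, hC₁, h1⟩ := exists_eventually_le_count hμ hlim hF hcmp hslope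
    refine IsBigO.trans_isLittleO (IsBigO.of_bound C₁ ?_)
      (isLittleO_count_typeIntegral hμ hlim hF hcmp hslope)
    filter_upwards [h1] with t h1
    rwa [Real.norm_eq_abs, abs_of_nonneg (hnonneg t), Real.norm_eq_abs,
      abs_of_nonneg (Nat.cast_nonneg _)]
  · refine IsBigO.trans_isLittleO (IsBigO.of_bound C₂ ?_)
      (hfast.isLittleO_sqrt_typeIntegral hμ hlim hF hcmp)
    filter_upwards [h2, hfast.eventually_mul_log_le hF hcmp] with t h2 h3
    rw [Real.norm_eq_abs, abs_of_nonneg (hnonneg t), Real.norm_eq_abs,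
      abs_of_nonneg (Real.sqrt_nonneg _)]
    exact h2 h3.1 h3.2

end Asymptotics

end EllipsoidEntropy

theorem theorem1 (μ : ℕ → ℝ) (hμ_nonneg : ∀ n, 0 ≤ μ n) (hμ : Tendsto μ atTop (𝓝 0))
    (hRC : EllipsoidEntropy.RegularityCondition
      (fun x => (EllipsoidEntropy.semiAxisCount μ x : ℝ))) :
    ((∃ m n : ℕ, m ≠ n ∧ 0 < μ m ∧ 0 < μ n) →
      (fun ε : ℝ => EllipsoidEntropy.metricEntropy ε (EllipsoidEntropy.ellipsoid μ)
          - EllipsoidEntropy.typeIntegral μ 1 ε)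
        =O[𝓝[>] 0]
      (fun ε : ℝ => min (EllipsoidEntropy.semiAxisCount μ ε : ℝ)
        (√((EllipsoidEntropy.semiAxisCount μ ε : ℝ)
          * Real.log (EllipsoidEntropy.semiAxisCount μ ε : ℝ) * Real.log ε⁻¹)))) ∧
    (fun ε : ℝ => EllipsoidEntropy.metricEntropy ε (EllipsoidEntropy.ellipsoid μ))
      ~[𝓝[>] 0] (fun ε : ℝ => EllipsoidEntropy.typeIntegral μ 1 ε) ∧
    (∀ ε : ℝ, 0 < ε →
      MeasureTheory.IntegrableOn
        (fun u : ℝ => (EllipsoidEntropy.semiAxisCount μ u : ℝ) / u ^ (1 : ℝ)) (Ioi ε) ∧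
      HasSum (fun n => Real.posLog (μ n / ε)) (EllipsoidEntropy.typeIntegral μ 1 ε)) := by
  obtain ⟨F, hF, hmono, hcmp, hslope⟩ := hRC.exists_log
  refine ⟨fun htwo => ?_, ?_, fun ε hε => ⟨?_, EllipsoidEntropy.hasSum_posLog hμ_nonneg hμ hε⟩⟩
  · obtain ⟨C, hC⟩ :=
      EllipsoidEntropy.exists_eventually_le_min hμ_nonneg hμ hF hmono hcmp hslope htwo
    refine IsBigO.of_bound C ?_
    filter_upwards [EllipsoidEntropy.eventually_nhdsGT_of_atTop
      (P := fun ε t => EllipsoidEntropy.metricEntropy ε (EllipsoidEntropy.ellipsoid μ) -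
        EllipsoidEntropy.typeIntegral μ 1 ε ≤ C * min (EllipsoidEntropy.semiAxisCount μ ε : ℝ)
          (√((EllipsoidEntropy.semiAxisCount μ ε : ℝ) *
            Real.log (EllipsoidEntropy.semiAxisCount μ ε) * t))) hC,
      self_mem_nhdsWithin] with ε h hε
    have hlow := EllipsoidEntropy.typeIntegral_le_metricEntropy hμ_nonneg hμ hε
    rwa [Real.norm_eq_abs, Real.norm_eq_abs, abs_of_nonneg (sub_nonneg.2 hlow),
      abs_of_nonneg (le_min (Nat.cast_nonneg _) (Real.sqrt_nonneg _))]
  · have h := EllipsoidEntropy.isLittleO_remainder hμ_nonneg hμ hF hmono hcmp hslope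
    refine isLittleO_iff.2 fun c hc => ?_
    exact EllipsoidEntropy.eventually_nhdsGT_of_atTop
      (P := fun ε _ => ‖EllipsoidEntropy.metricEntropy ε (EllipsoidEntropy.ellipsoid μ) -
        EllipsoidEntropy.typeIntegral μ 1 ε‖ ≤ c * ‖EllipsoidEntropy.typeIntegral μ 1 ε‖)
      (isLittleO_iff.1 h hc)
  · obtain ⟨S, hS, -⟩ := EllipsoidEntropy.exists_finset_axes hμ hε
    exact (EllipsoidEntropy.typeIntegral_aux hμ hε hS).1
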